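/- Let $k$ be a field and let $\mathscr C$ be a finite EI category, that is, a category with finitely many objects and finitely many morphisms in which every endomorphism is an isomorphism. Let $k\mathscr C$ be its category algebra: the $k$-vector space with basis the set of all morphisms of $\mathscr C$, with product of two morphisms $\alpha * \beta = \alpha\circ\beta$ if $\alpha$ and $\beta$ can be composed and $\alpha * \beta = 0$ otherwise, and with unit $\sum_{x} \mathrm{Id}_x$, the sum being over all objects $x$ of $\mathscr C$. Then $k\mathscr C$ is Gorenstein if and only if $\mathscr C$ is projective over $k$. Here a ring $R$ is Gorenstein if it is left and right noetherian and has finite injective dimension both as a left and as a right module over itself. The category $\mathscr C$ is projective over $k$ if for all objects $x,y$ the vector space $k\mathrm{Hom}_{\mathscr C}(x,y)$ with basis $\mathrm{Hom}_{\mathscr C}(x,y)$ is projective as a left $k\mathrm{Aut}_{\mathscr C}(y)$-module and as a right $k\mathrm{Aut}_{\mathscr C}(x)$-module, where the group algebras act by composition of morphisms. -/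

import Mathlib

open CategoryTheory

universe w v u

namespace EICat

/-! ### Finite EI categories -/

/-- The EI condition: every endomorphism is an isomorphism. -/
def IsEI (C : Type u) [Category.{v} C] : Prop :=
  ∀ ⦃x : C⦄ (f : x ⟶ x), IsIso f

/-- All morphisms of `C`: triples of a domain, a codomain and a morphism between them. -/
abbrev Mor (C : Type u) [Category.{v} C] : Type (max u v) :=
  Σ x : C, Σ y : C, (x ⟶ y)

/-- An arrow `f : x ⟶ y`, as an element of `Mor C`. -/
abbrev Mor.of {C : Type u} [Category.{v} C] {x y : C} (f : x ⟶ y) : Mor C := ⟨x, y, f⟩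

/-! ### The category algebra -/

/-- The underlying module of the category algebra: the free `k`-module on all morphisms. -/
def CategoryAlgebra (k : Type w) [CommRing k] (C : Type u) [Category.{v} C] : Type (max u v w) :=
  Mor C →₀ k

namespace CategoryAlgebra

variable (k : Type w) [CommRing k] {C : Type u} [Category.{v} C]

noncomputable instance : AddCommGroup (CategoryAlgebra k C) :=
  inferInstanceAs (AddCommGroup (Mor C →₀ k))

noncomputable instance : Module k (CategoryAlgebra k C) :=
  inferInstanceAs (Module k (Mor C →₀ k))

/-- The basis of the category algebra given by the morphisms. -/
noncomputable def basis (C : Type u) [Category.{v} C] :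
    Module.Basis (Mor C) k (CategoryAlgebra k C) :=
  Module.Basis.ofRepr (LinearEquiv.refl k (Mor C →₀ k))

open Classical in
/-- The product `α * β` of two morphisms: `α ∘ β` (first `β`, then `α`) when the codomain of `β`
is the domain of `α`, and `0` otherwise. -/
noncomputable def mulMor (α β : Mor C) : CategoryAlgebra k C :=
  if h : β.2.1 = α.1 then basis k C (Mor.of (β.2.2 ≫ eqToHom h ≫ α.2.2)) else 0

/-- The multiplication of the category algebra: the bilinear extension of `mulMor`. -/
noncomputable def mulLin (C : Type u) [Category.{v} C] :
    CategoryAlgebra k C →ₗ[k] CategoryAlgebra k C →ₗ[k] CategoryAlgebra k C :=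
  (basis k C).constr k fun α => (basis k C).constr k fun β => mulMor k α β

noncomputable instance : Mul (CategoryAlgebra k C) := ⟨fun a b => mulLin k C a b⟩

/-- The sum of all identity morphisms (meaningful when `C` has finitely many objects). -/
noncomputable instance : One (CategoryAlgebra k C) := ⟨∑ᶠ x : C, basis k C (Mor.of (𝟙 x))⟩

theorem mul_def (a b : CategoryAlgebra k C) : a * b = mulLin k C a b := rfl

theorem one_def : (1 : CategoryAlgebra k C) = ∑ᶠ x : C, basis k C (Mor.of (𝟙 x)) := rfl

theorem basis_mul_basis (α β : Mor C) : basis k C α * basis k C β = mulMor k α β := by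
  simp [mul_def, mulLin]

theorem basis_mul_basis_comp {x y z : C} (f : x ⟶ y) (g : y ⟶ z) :
    basis k C (Mor.of g) * basis k C (Mor.of f) = basis k C (Mor.of (f ≫ g)) := by
  simp [basis_mul_basis, mulMor]

theorem basis_mul_basis_of_ne {x y y' z : C} (f : x ⟶ y) (g : y' ⟶ z) (h : y ≠ y') :
    basis k C (Mor.of g) * basis k C (Mor.of f) = 0 := by
  simp [basis_mul_basis, mulMor, h]

theorem mulLin_assoc (a b c : CategoryAlgebra k C) :
    mulLin k C (mulLin k C a b) c = mulLin k C a (mulLin k C b c) := by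
  suffices H : (LinearMap.llcomp k _ _ _ (mulLin k C)).comp (mulLin k C) =
      ((LinearMap.llcomp k _ _ _).flip (mulLin k C)).comp
        ((LinearMap.llcomp k _ _ _).comp (mulLin k C)) by
    exact LinearMap.congr_fun (LinearMap.congr_fun (LinearMap.congr_fun H a) b) c
  refine (basis k C).ext fun α => (basis k C).ext fun β => (basis k C).ext fun γ => ?_
  obtain ⟨x, y, f⟩ := α
  obtain ⟨x', y', g⟩ := β
  obtain ⟨x'', y'', h⟩ := γ
  change (basis k C (Mor.of f) * basis k C (Mor.of g)) * basis k C (Mor.of h) =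
    basis k C (Mor.of f) * (basis k C (Mor.of g) * basis k C (Mor.of h))
  by_cases h1 : y' = x
  · subst h1
    by_cases h2 : y'' = x'
    · subst h2
      simp only [basis_mul_basis_comp, Category.assoc]
    · rw [basis_mul_basis_comp, basis_mul_basis_of_ne k _ _ h2, basis_mul_basis_of_ne k _ _ h2]
      simp [mul_def]
  · rw [basis_mul_basis_of_ne k _ _ h1]
    by_cases h2 : y'' = x'
    · subst h2
      rw [basis_mul_basis_comp, basis_mul_basis_of_ne k _ _ h1]
      simp [mul_def]
    · rw [basis_mul_basis_of_ne k _ _ h2]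
      simp [mul_def]

section Finite

variable [Finite C]

theorem one_mul_basis (α : Mor C) : 1 * basis k C α = basis k C α := by
  obtain ⟨x, y, f⟩ := α
  have := Fintype.ofFinite C
  rw [one_def, finsum_eq_sum_of_fintype, mul_def, map_sum, LinearMap.sum_apply,
    Finset.sum_eq_single y]
  · change basis k C (Mor.of (𝟙 y)) * basis k C (Mor.of f) = basis k C (Mor.of f)
    rw [basis_mul_basis_comp, Category.comp_id]
  · intro z _ hz
    exact basis_mul_basis_of_ne k f (𝟙 z) (Ne.symm hz)
  · simp

theorem basis_mul_one (α : Mor C) : basis k C α * 1 = basis k C α := by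
  obtain ⟨x, y, f⟩ := α
  have := Fintype.ofFinite C
  rw [one_def, finsum_eq_sum_of_fintype, mul_def, map_sum, Finset.sum_eq_single x]
  · change basis k C (Mor.of f) * basis k C (Mor.of (𝟙 x)) = basis k C (Mor.of f)
    rw [basis_mul_basis_comp, Category.id_comp]
  · intro z _ hz
    exact basis_mul_basis_of_ne k (𝟙 z) f hz
  · simp

/-- The category algebra of a category with finitely many objects is a unital ring. -/
noncomputable instance : Ring (CategoryAlgebra k C) :=
  { (inferInstance : AddCommGroup (CategoryAlgebra k C)),
    (inferInstance : Mul (CategoryAlgebra k C)),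
    (inferInstance : One (CategoryAlgebra k C)) with
    mul_assoc := mulLin_assoc k
    zero_mul := fun a => by simp [mul_def]
    mul_zero := fun a => by simp [mul_def]
    left_distrib := fun a b c => by simp [mul_def]
    right_distrib := fun a b c => by simp [mul_def]
    one_mul := fun a => by
      have H : mulLin k C 1 = LinearMap.id := (basis k C).ext fun α => one_mul_basis k α
      exact LinearMap.congr_fun H a
    mul_one := fun a => by
      have H : (mulLin k C).flip 1 = LinearMap.id := (basis k C).ext fun α => basis_mul_one k α
      exact LinearMap.congr_fun H a }

noncomputable instance : Algebra k (CategoryAlgebra k C) :=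
  Algebra.ofModule (fun r a b => by simp [mul_def]) (fun r a b => by simp [mul_def])

end Finite

end CategoryAlgebra

/-! ### The bimodules `k Hom(x, y)` -/

/-- The free `k`-module on `Hom(x, y)`. -/
def HomModule (k : Type w) [CommRing k] {C : Type u} [Category.{v} C] (x y : C) : Type (max v w) :=
  (x ⟶ y) →₀ k

namespace HomModule

variable (k : Type w) [CommRing k] {C : Type u} [Category.{v} C] (x y : C)

noncomputable instance : AddCommGroup (HomModule k x y) :=
  inferInstanceAs (AddCommGroup ((x ⟶ y) →₀ k))

noncomputable instance : Module k (HomModule k x y) :=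
  inferInstanceAs (Module k ((x ⟶ y) →₀ k))

/-- The basis of `k Hom(x, y)` given by the morphisms from `x` to `y`. -/
noncomputable def basis : Module.Basis (x ⟶ y) k (HomModule k x y) :=
  Module.Basis.ofRepr (LinearEquiv.refl k ((x ⟶ y) →₀ k))

/-- `Aut(y)` acts on `k Hom(x, y)` from the left by `g · α = g ∘ α`. -/
noncomputable def leftHom : Aut y →* Module.End k (HomModule k x y) where
  toFun g := (basis k x y).constr k fun α => basis k x y (α ≫ g.hom)
  map_one' := (basis k x y).ext fun α => by simp [show (1 : Aut y).hom = 𝟙 y from rfl]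
  map_mul' g h := (basis k x y).ext fun α => by
    simp [show (g * h).hom = h.hom ≫ g.hom from rfl]

/-- `Aut(x)` acts on `k Hom(x, y)` from the right by `α · h = α ∘ h`. -/
noncomputable def rightHom : Aut x →* (Module.End k (HomModule k x y))ᵐᵒᵖ where
  toFun h := MulOpposite.op ((basis k x y).constr k fun α => basis k x y (h.hom ≫ α))
  map_one' := MulOpposite.unop_injective <| (basis k x y).ext fun α => by
    simp [show (1 : Aut x).hom = 𝟙 x from rfl]
  map_mul' g h := MulOpposite.unop_injective <| (basis k x y).ext fun α => by
    simp [show (g * h).hom = h.hom ≫ g.hom from rfl]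

/-- The left `k Aut(y)`-module structure on `k Hom(x, y)`. -/
noncomputable instance leftModule : Module (MonoidAlgebra k (Aut y)) (HomModule k x y) :=
  Module.compHom (HomModule k x y)
    (MonoidAlgebra.lift k (Module.End k (HomModule k x y)) (Aut y) (leftHom k x y)).toRingHom

/-- The right `k Aut(x)`-module structure on `k Hom(x, y)`, as a left module structure over the
opposite ring. -/
noncomputable instance rightModule : Module (MonoidAlgebra k (Aut x))ᵐᵒᵖ (HomModule k x y) :=
  Module.compHom (HomModule k x y)
    (AlgHom.opComm (MonoidAlgebra.lift k (Module.End k (HomModule k x y))ᵐᵒᵖ (Aut x)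
      (rightHom k x y))).toRingHom

theorem left_smul_basis (g : Aut y) (r : k) (α : x ⟶ y) :
    (MonoidAlgebra.single g r : MonoidAlgebra k (Aut y)) • basis k x y α =
      r • basis k x y (α ≫ g.hom) := by
  change (MonoidAlgebra.lift k (Module.End k (HomModule k x y)) (Aut y) (leftHom k x y)
    (MonoidAlgebra.single g r)) (basis k x y α) = _
  simp [leftHom]

theorem right_smul_basis (h : Aut x) (r : k) (α : x ⟶ y) :
    MulOpposite.op (MonoidAlgebra.single h r : MonoidAlgebra k (Aut x)) • basis k x y α =
      r • basis k x y (h.hom ≫ α) := by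
  change (MonoidAlgebra.lift k (Module.End k (HomModule k x y))ᵐᵒᵖ (Aut x) (rightHom k x y)
    (MonoidAlgebra.single h r)).unop (basis k x y α) = _
  simp [rightHom]

end HomModule

/-- `C` is projective over `k`: each bimodule `k Hom(x, y)` is projective as a left
`k Aut(y)`-module and as a right `k Aut(x)`-module. -/
def IsProjectiveOver (k : Type w) [CommRing k] (C : Type u) [Category.{v} C] : Prop :=
  ∀ x y : C, Module.Projective (MonoidAlgebra k (Aut y)) (HomModule k x y) ∧
    Module.Projective (MonoidAlgebra k (Aut x))ᵐᵒᵖ (HomModule k x y)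

/-! ### Gorenstein rings -/

/-- A ring is Gorenstein if it is left and right noetherian, and has finite injective dimension both
as a left and as a right module over itself. Right modules are modules over the opposite ring. -/
structure IsGorenstein (R : Type u) [Ring R] : Prop where
  left_noetherian : IsNoetherianRing R
  right_noetherian : IsNoetherianRing Rᵐᵒᵖ
  left_injectiveDimension : injectiveDimension (ModuleCat.of R R) < ⊤
  right_injectiveDimension : injectiveDimension (ModuleCat.of Rᵐᵒᵖ R) < ⊤

end EICat

/-!
# Gorenstein category algebras of finite EI categories

Let `A` be the category algebra. The identities of the objects form a complete family of orthogonal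
idempotents `e x`, the objects are preordered by the existence of morphisms, and `e y * A * e x`,
which is `k Hom(x, y)`, vanishes unless `x ≤ y`. By the EI condition the corner `e y * A * e y` is
the group algebra of `Aut y`, a Frobenius algebra, and objects `x ≤ y ≤ x` are isomorphic. The
structure `CornerData` records these properties. They pass to the opposite algebra, so that each
argument about left modules also serves for right modules. The category is projective over `k` when
the components `e y * A` and `A * e x` are projective over the corners at `y` and `x`; this is
`CornerData.IsCornerProjective` for the left and the right regular module.

For an object `y`, the standard module at `y` is the quotient of `A * e y` by its part supported
strictly above `y`. The modules supported on the isomorphism class of `y` are governed by it: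
they are summands of its powers when their component is projective
(`CornerData.SupportedAt.exists_retract`), and the finite-dimensional ones always embed into its
powers, by the Frobenius property (`CornerData.SupportedAt.exists_embedding`). Filtering by the
support, it follows that a module supported on an upper set `U` with projective components belongs
to every thick family of modules containing `A * e y` for `y ∈ U`, provided that the components of
`A` at the objects of `U` are projective (`IsThick.of_isCornerProjective`). This is used for three
families: the modules of finite injective dimension, the modules `M` with `Ext^*(M, F) = 0` for a
given `F`, and the modules whose dual has finite injective dimension.

If all components on both sides are projective, then the dual of the right regular module has
projective components, again by the Frobenius property, so it lies in the third family, and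
dualizing back bounds the injective dimension of the right regular module.

Conversely, suppose that `A` has finite injective dimension as a left module. Going down the
preorder, let the components of `A` strictly above `y` be projective, and let `F` be the quotient of
`A` by its part supported there. Then `F` has finite injective dimension, and the standard module at
`y` has no higher extensions by `F`. Dimension shifting along embeddings into powers of the standard
module shows that no finite-dimensional module supported at `y` has higher extensions by `F`. So the
submodule of `F` supported at `y`, embedded into such a power, is a direct summand of it, and
`e y * F`, which is the component `e y * A`, is projective.
-/

open CategoryTheory

namespace EICat

/-! ### Thick families of modules -/

section Thick

variable (k : Type w) [Field k] (A : Type v) [Ring A] [Algebra k A]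

/-- A property of `A`-modules; the modules carry a compatible `k`-module structure, so that
`k`-linear maps between them can be talked about. -/
abbrev ModuleFamily : Type (max w (v + 1)) :=
  ∀ (M : Type v) [AddCommGroup M] [Module k M] [Module A M] [IsScalarTower k A M], Prop

variable {k A}

/-- A family of modules containing `0` and closed under retracts, extensions, and cokernels of
monomorphisms. -/
structure IsThick (Φ : ModuleFamily k A) : Prop where
  of_subsingleton : ∀ (M : Type v) [AddCommGroup M] [Module k M] [Module A M]
    [IsScalarTower k A M] [Subsingleton M], Φ M
  of_retract : ∀ {M N : Type v} [AddCommGroup M] [Module k M] [Module A M] [IsScalarTower k A M]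
    [AddCommGroup N] [Module k N] [Module A N] [IsScalarTower k A N]
    (i : M →ₗ[A] N) (r : N →ₗ[A] M), (∀ m, r (i m) = m) → Φ N → Φ M
  of_ext : ∀ {X Y Z : Type v} [AddCommGroup X] [Module k X] [Module A X] [IsScalarTower k A X]
    [AddCommGroup Y] [Module k Y] [Module A Y] [IsScalarTower k A Y]
    [AddCommGroup Z] [Module k Z] [Module A Z] [IsScalarTower k A Z]
    (f : X →ₗ[A] Y) (g : Y →ₗ[A] Z), Function.Injective f → Function.Surjective g →
    Function.Exact f g → Φ X → Φ Z → Φ Y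
  of_coker : ∀ {X Y Z : Type v} [AddCommGroup X] [Module k X] [Module A X] [IsScalarTower k A X]
    [AddCommGroup Y] [Module k Y] [Module A Y] [IsScalarTower k A Y]
    [AddCommGroup Z] [Module k Z] [Module A Z] [IsScalarTower k A Z]
    (f : X →ₗ[A] Y) (g : Y →ₗ[A] Z), Function.Injective f → Function.Surjective g →
    Function.Exact f g → Φ X → Φ Y → Φ Z

/-- A family of modules closed under extensions and containing `0` is closed under finite
powers. -/
theorem ModuleFamily.pow {Φ : ModuleFamily k A}
    (h0 : ∀ (M : Type v) [AddCommGroup M] [Module k M] [Module A M]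
      [IsScalarTower k A M] [Subsingleton M], Φ M)
    (hext : ∀ {X Y Z : Type v} [AddCommGroup X] [Module k X] [Module A X] [IsScalarTower k A X]
      [AddCommGroup Y] [Module k Y] [Module A Y] [IsScalarTower k A Y]
      [AddCommGroup Z] [Module k Z] [Module A Z] [IsScalarTower k A Z]
      (f : X →ₗ[A] Y) (g : Y →ₗ[A] Z), Function.Injective f → Function.Surjective g →
      Function.Exact f g → Φ X → Φ Z → Φ Y)
    {M : Type v} [AddCommGroup M] [Module k M] [Module A M] [IsScalarTower k A M] (hM : Φ M)
    (n : ℕ) : Φ (Fin n → M) := by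
  induction n with
  | zero => exact h0 _
  | succ n ih =>
    refine hext (LinearMap.single A (fun _ : Fin (n + 1) => M) 0)
      (LinearMap.funLeft A M Fin.succ) (Pi.single_injective (M := fun _ : Fin (n + 1) => M) 0)
      (LinearMap.funLeft_surjective_of_injective A M _ (Fin.succ_injective n)) ?_ hM ih
    intro x
    constructor
    · intro hx
      refine ⟨x 0, ?_⟩
      funext j
      refine Fin.cases ?_ (fun j => ?_) j
      · simp
      · have := congrFun hx j
        simp only [LinearMap.funLeft_apply, Pi.zero_apply] at this
        simp [this]
    · rintro ⟨m, rfl⟩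
      funext j
      simp [LinearMap.funLeft_apply]

end Thick

/-! ### Injective dimension and orthogonality for `Ext` -/

section Homological

variable {R : Type u} [Ring R] {X Y Z : Type v} [AddCommGroup X] [Module R X]
  [AddCommGroup Y] [Module R Y] [AddCommGroup Z] [Module R Z]

/-- A short exact sequence of modules, as a short exact sequence in `ModuleCat R`. -/
theorem exists_shortExact (f : X →ₗ[R] Y) (g : Y →ₗ[R] Z) (hf : Function.Injective f)
    (hg : Function.Surjective g) (hfg : Function.Exact f g) :
    (ModuleCat.shortComplexOfCompEqZero f g hfg.linearMap_comp_eq_zero).ShortExact :=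
  ModuleCat.shortComplex_shortExact _ hfg hf hg

variable (R) in
/-- The module `M` has finite injective dimension over `R`. -/
def HasFiniteInjectiveDimension (M : Type v) [AddCommGroup M] [Module R M] : Prop :=
  ∃ n, HasInjectiveDimensionLT (ModuleCat.of R M) n

theorem hasFiniteInjectiveDimension_iff (M : Type v) [AddCommGroup M] [Module R M] :
    HasFiniteInjectiveDimension R M ↔ injectiveDimension (ModuleCat.of R M) < ⊤ := by
  rw [lt_top_iff_ne_top, injectiveDimension_ne_top_iff]
  exact ⟨fun ⟨n, h⟩ => ⟨n, hasInjectiveDimensionLT_of_ge _ n _ (Nat.le_succ n)⟩,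
    fun ⟨n, h⟩ => ⟨_, h⟩⟩

namespace HasFiniteInjectiveDimension

theorem of_subsingleton [Subsingleton X] : HasFiniteInjectiveDimension R X :=
  ⟨0, Limits.IsZero.hasInjectiveDimensionLT_zero (ModuleCat.isZero_of_subsingleton _)⟩

theorem of_retract (i : X →ₗ[R] Y) (r : Y →ₗ[R] X) (h : ∀ x, r (i x) = x)
    (hY : HasFiniteInjectiveDimension R Y) : HasFiniteInjectiveDimension R X := by
  obtain ⟨n, hn⟩ := hY
  let ret : Retract (ModuleCat.of R X) (ModuleCat.of R Y) :=
    { i := ModuleCat.ofHom i, r := ModuleCat.ofHom r, retract := by ext x; exact h x }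
  exact ⟨n, ret.hasInjectiveDimensionLT n⟩

theorem of_ext (f : X →ₗ[R] Y) (g : Y →ₗ[R] Z) (hf : Function.Injective f)
    (hg : Function.Surjective g) (hfg : Function.Exact f g)
    (hX : HasFiniteInjectiveDimension R X) (hZ : HasFiniteInjectiveDimension R Z) :
    HasFiniteInjectiveDimension R Y := by
  obtain ⟨m, hm⟩ := hX
  obtain ⟨n, hn⟩ := hZ
  refine ⟨max m n, (exists_shortExact f g hf hg hfg).hasInjectiveDimensionLT_X₂ _ ?_ ?_⟩
  · exact hasInjectiveDimensionLT_of_ge _ m _ (le_max_left m n)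
  · exact hasInjectiveDimensionLT_of_ge _ n _ (le_max_right m n)

theorem of_coker (f : X →ₗ[R] Y) (g : Y →ₗ[R] Z) (hf : Function.Injective f)
    (hg : Function.Surjective g) (hfg : Function.Exact f g)
    (hX : HasFiniteInjectiveDimension R X) (hY : HasFiniteInjectiveDimension R Y) :
    HasFiniteInjectiveDimension R Z := by
  obtain ⟨m, hm⟩ := hX
  obtain ⟨n, hn⟩ := hY
  refine ⟨max m n, (exists_shortExact f g hf hg hfg).hasInjectiveDimensionLT_X₃ _ ?_ ?_⟩
  · exact hasInjectiveDimensionLT_of_ge _ n _ (le_max_right m n)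
  · exact hasInjectiveDimensionLT_of_ge _ m _ ((le_max_left m n).trans (Nat.le_succ _))

theorem of_ker (f : X →ₗ[R] Y) (g : Y →ₗ[R] Z) (hf : Function.Injective f)
    (hg : Function.Surjective g) (hfg : Function.Exact f g)
    (hY : HasFiniteInjectiveDimension R Y) (hZ : HasFiniteInjectiveDimension R Z) :
    HasFiniteInjectiveDimension R X := by
  obtain ⟨m, hm⟩ := hY
  obtain ⟨n, hn⟩ := hZ
  refine ⟨max m n + 1, (exists_shortExact f g hf hg hfg).hasInjectiveDimensionLT_X₁ _ ?_ ?_⟩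
  · exact hasInjectiveDimensionLT_of_ge _ n _ (le_max_right m n)
  · exact hasInjectiveDimensionLT_of_ge _ m _ ((le_max_left m n).trans (Nat.le_succ _))

theorem of_injective [Small.{v} R] [Module.Injective R X] : HasFiniteInjectiveDimension R X :=
  have := (Module.injective_iff_injective_object R X).1 inferInstance
  ⟨1, inferInstance⟩

end HasFiniteInjectiveDimension

end Homological

section Ext

open Abelian

variable {A : Type v} [Ring A] {X Y Z M F : Type v} [AddCommGroup X] [Module A X]
  [AddCommGroup Y] [Module A Y] [AddCommGroup Z] [Module A Z] [AddCommGroup M] [Module A M]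
  [AddCommGroup F] [Module A F]

variable (A) in
/-- The group `Extⁱ(M, F)` vanishes. -/
def ExtVanishes (i : ℕ) (M F : Type v) [AddCommGroup M] [Module A M] [AddCommGroup F]
    [Module A F] : Prop :=
  ∀ e : Ext.{v} (ModuleCat.of A M) (ModuleCat.of A F) i, e = 0

namespace ExtVanishes

theorem zero_iff : ExtVanishes A 0 M F ↔ ∀ f : M →ₗ[A] F, f = 0 := by
  constructor
  · intro h f
    have := h (Ext.mk₀ (ModuleCat.ofHom f))
    rw [Ext.mk₀_eq_zero_iff] at this
    simpa using congrArg ModuleCat.Hom.hom this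
  · intro h e
    obtain ⟨f, rfl⟩ := Ext.homEquiv₀.symm.surjective e
    have : f = 0 := by ext x; simp [h f.hom]
    simp [this]

theorem of_subsingleton [Subsingleton M] (i : ℕ) : ExtVanishes A i M F := fun e => by
  rw [← Ext.mk₀_id_comp e, (ModuleCat.isZero_of_subsingleton (ModuleCat.of A M)).eq_of_src (𝟙 _) 0,
    Ext.mk₀_zero, Ext.zero_comp]

theorem of_projective [Module.Projective A M] (i : ℕ) : ExtVanishes A (i + 1) M F := fun e => by
  have : Projective (ModuleCat.of A M) := (IsProjective.iff_projective M).1 inferInstance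
  exact e.eq_zero_of_projective

theorem of_retract (i : X →ₗ[A] Y) (r : Y →ₗ[A] X) (h : ∀ x, r (i x) = x) {n : ℕ}
    (hY : ExtVanishes A n Y F) : ExtVanishes A n X F := fun e => by
  have h1 : ModuleCat.ofHom i ≫ ModuleCat.ofHom r = 𝟙 (ModuleCat.of A X) := by ext x; exact h x
  rw [← Ext.mk₀_id_comp e, ← h1, ← Ext.mk₀_comp_mk₀_assoc,
    hY ((Ext.mk₀ (ModuleCat.ofHom r)).comp e (zero_add n)), Ext.comp_zero]

theorem of_coker_zero {g : Y →ₗ[A] Z} (hg : Function.Surjective g) (hY : ExtVanishes A 0 Y F) :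
    ExtVanishes A 0 Z F := by
  rw [zero_iff] at *
  intro h
  ext z
  obtain ⟨y, rfl⟩ := hg z
  exact LinearMap.congr_fun (hY (h ∘ₗ g)) y

variable {f : X →ₗ[A] Y} {g : Y →ₗ[A] Z} (hf : Function.Injective f)
    (hg : Function.Surjective g) (hfg : Function.Exact f g)
include hf hg hfg

theorem of_ext {n : ℕ} (hX : ExtVanishes A n X F) (hZ : ExtVanishes A n Z F) :
    ExtVanishes A n Y F := fun e => by
  obtain ⟨x, rfl⟩ := Ext.contravariant_sequence_exact₂ (exists_shortExact f g hf hg hfg) _ e (hX _)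
  rw [hZ x, Ext.comp_zero]

theorem of_coker_succ {n : ℕ} (hX : ExtVanishes A n X F) (hY : ExtVanishes A (n + 1) Y F) :
    ExtVanishes A (n + 1) Z F := fun e => by
  obtain ⟨x, rfl⟩ := Ext.contravariant_sequence_exact₃ (exists_shortExact f g hf hg hfg) _ e (hY _)
    (add_comm 1 n)
  rw [hX x, Ext.comp_zero]

/-- Dimension shifting along a short exact sequence. -/
theorem of_ker {n : ℕ} (hY : ExtVanishes A n Y F) (hZ : ExtVanishes A (n + 1) Z F) :
    ExtVanishes A n X F := fun e => by
  obtain ⟨y, rfl⟩ := Ext.contravariant_sequence_exact₁ (exists_shortExact f g hf hg hfg) _ e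
    (add_comm 1 n) (hZ _)
  rw [hY y, Ext.comp_zero]

/-- If `Ext¹(Z, F) = 0`, every homomorphism `X → F` extends along the inclusion `X → Y` with
cokernel `Z`. -/
theorem exists_extension (hZ : ExtVanishes A 1 Z F) (h : X →ₗ[A] F) :
    ∃ h' : Y →ₗ[A] F, ∀ x, h' (f x) = h x := by
  obtain ⟨y, hy⟩ := Ext.contravariant_sequence_exact₁ (exists_shortExact f g hf hg hfg) _
    (Ext.mk₀ (ModuleCat.ofHom h)) (add_zero 1) (hZ _)
  obtain ⟨y, rfl⟩ := Ext.homEquiv₀.symm.surjective y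
  rw [Ext.homEquiv₀_symm_apply, Ext.mk₀_comp_mk₀] at hy
  have h2 := Ext.homEquiv₀.symm.injective hy
  exact ⟨y.hom, fun x => LinearMap.congr_fun (congrArg ModuleCat.Hom.hom h2) x⟩

end ExtVanishes

section

variable {k : Type w} [Field k] [Algebra k A]

theorem isThick_hasFiniteInjectiveDimension :
    IsThick (k := k) (A := A) fun M _ _ _ _ => HasFiniteInjectiveDimension A M where
  of_subsingleton _ := .of_subsingleton
  of_retract := .of_retract
  of_ext := .of_ext
  of_coker := .of_coker

theorem isThick_extVanishes (F : Type v) [AddCommGroup F] [Module A F] :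
    IsThick (k := k) (A := A) fun M _ _ _ _ => ∀ i, ExtVanishes A i M F where
  of_subsingleton _ := .of_subsingleton
  of_retract i r h hN n := (hN n).of_retract i r h
  of_ext _ _ hf hg hfg hX hZ n := .of_ext hf hg hfg (hX n) (hZ n)
  of_coker _ _ hf hg hfg hX hY n := by
    cases n with
    | zero => exact .of_coker_zero hg (hY 0)
    | succ n => exact .of_coker_succ hf hg hfg (hX n) (hY (n + 1))

end

end Ext

/-! ### Algebras with a directed system of Frobenius corners -/

/-- A complete family of orthogonal idempotents `e i` of an algebra `A`, indexed by a finite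
preorder, such that `e j * A * e i = 0` unless `i ≤ j`, equivalent indices give isomorphic
idempotents, and each corner `e i * A * e i` is a Frobenius algebra. The Frobenius property is
encoded by a functional `l` and two families `u`, `v` in the corner that are dual to each other
under the form `(a, b) ↦ l (a * b)`. -/
structure CornerData (k : Type w) [Field k] (A : Type v) [Ring A] [Algebra k A]
    (ι : Type u) [Fintype ι] [Preorder ι] where
  /-- The idempotents. -/
  e : ι → A
  e_mul_self : ∀ i, e i * e i = e i
  e_mul_of_ne : ∀ {i j}, i ≠ j → e i * e j = 0
  sum_e : ∑ i, e i = 1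
  corner_eq_zero : ∀ {i j}, ¬ i ≤ j → ∀ a, e j * a * e i = 0
  exists_iso : ∀ {i j}, i ≤ j → j ≤ i → ∃ s t : A, e j * s = s ∧ s * e i = s ∧
    e i * t = t ∧ t * e j = t ∧ s * t = e j ∧ t * s = e i
  exists_frobenius : ∀ i, ∃ (n : ℕ) (l : A →ₗ[k] k) (u v : Fin n → A),
    (∀ g, e i * u g * e i = u g) ∧ (∀ g, e i * v g * e i = v g) ∧
    (∀ a, ∑ g, l (e i * a * e i * u g) • v g = e i * a * e i) ∧
    (∀ a, ∑ g, l (v g * (e i * a * e i)) • u g = e i * a * e i)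

namespace CornerData

variable {k : Type w} [Field k] {A : Type v} [Ring A] [Algebra k A]
  {ι : Type u} [Fintype ι] [Preorder ι] (D : CornerData k A ι)

/-- The same idempotents in the opposite algebra, with the order reversed. -/
def op : CornerData k Aᵐᵒᵖ ιᵒᵈ where
  e i := .op (D.e (OrderDual.ofDual i))
  e_mul_self i := MulOpposite.unop_injective (D.e_mul_self _)
  e_mul_of_ne h := MulOpposite.unop_injective (D.e_mul_of_ne fun h' => h (by simpa using h'.symm))
  sum_e := MulOpposite.unop_injective (by
    rw [← MulOpposite.opAddEquiv_symm_apply, map_sum]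
    exact D.sum_e)
  corner_eq_zero {i j} h a := MulOpposite.unop_injective (by
    have := D.corner_eq_zero (i := OrderDual.ofDual j) (j := OrderDual.ofDual i) h a.unop
    simpa [mul_assoc] using this)
  exists_iso {i j} hij hji := by
    obtain ⟨s, t, h1, h2, h3, h4, h5, h6⟩ :=
      D.exists_iso (i := OrderDual.ofDual i) (j := OrderDual.ofDual j) hji hij
    refine ⟨.op t, .op s, ?_, ?_, ?_, ?_, ?_, ?_⟩ <;> apply MulOpposite.unop_injective <;> simpa
  exists_frobenius i := by
    obtain ⟨n, l, u, v, hu, hv, h1, h2⟩ := D.exists_frobenius (OrderDual.ofDual i)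
    refine ⟨n, l ∘ₗ (MulOpposite.opLinearEquiv k).symm.toLinearMap, fun g => .op (v g),
      fun g => .op (u g), fun g => ?_, fun g => ?_, fun a => ?_, fun a => ?_⟩ <;>
      apply MulOpposite.unop_injective
    · simpa [mul_assoc] using hv g
    · simpa [mul_assoc] using hu g
    · have := h2 a.unop
      simpa [mul_assoc, Finset.unop_sum] using this
    · have := h1 a.unop
      simpa [mul_assoc, Finset.unop_sum] using this

theorem e_mul_e_mul (i : ι) (a : A) : D.e i * (D.e i * a) = D.e i * a := by
  rw [← mul_assoc, D.e_mul_self]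

section Modules

variable {M N : Type*} [AddCommGroup M] [Module A M] [AddCommGroup N] [Module A N]

theorem sum_smul (m : M) : ∑ i, D.e i • m = m := by
  rw [← Finset.sum_smul, D.sum_e, one_smul]

theorem e_smul_e_smul (i : ι) (m : M) : D.e i • D.e i • m = D.e i • m := by
  rw [smul_smul, D.e_mul_self]

theorem e_smul_e_smul_of_ne {i j : ι} (h : i ≠ j) (m : M) : D.e i • D.e j • m = 0 := by
  rw [smul_smul, D.e_mul_of_ne h, zero_smul]

variable (M) in
/-- The module `M` vanishes at the index `i`: `e i • M = 0`. -/
def Vanishes (i : ι) : Prop := ∀ m : M, D.e i • m = 0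

theorem Vanishes.of_injective {i : ι} (h : D.Vanishes N i) (f : M →ₗ[A] N)
    (hf : Function.Injective f) : D.Vanishes M i := fun m => hf (by rw [map_smul, h, map_zero])

theorem Vanishes.of_surjective {i : ι} (h : D.Vanishes M i) (f : M →ₗ[A] N)
    (hf : Function.Surjective f) : D.Vanishes N i := fun n => by
  obtain ⟨m, rfl⟩ := hf n
  rw [← map_smul, h, map_zero]

theorem Vanishes.pow {i : ι} (h : D.Vanishes M i) (n : ℕ) : D.Vanishes (Fin n → M) i :=
  fun _ => funext fun _ => h _

variable (M) in
/-- The largest submodule supported on an upper set of indices. -/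
def part (U : UpperSet ι) : Submodule A M where
  carrier := {m | ∀ i ∉ U, D.e i • m = 0}
  add_mem' ha hb i hi := by rw [smul_add, ha i hi, hb i hi, add_zero]
  zero_mem' i _ := smul_zero _
  smul_mem' a m hm i hi := by
    rw [← D.sum_smul m, Finset.smul_sum, Finset.smul_sum]
    refine Finset.sum_eq_zero fun j _ => ?_
    by_cases hj : j ∈ U
    · have : ¬ j ≤ i := fun h => hi (U.upper h hj)
      rw [← D.e_smul_e_smul j m, smul_smul, smul_smul, D.corner_eq_zero this, zero_smul]
    · rw [hm j hj, smul_zero, smul_zero]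

theorem e_smul_mem_part {U : UpperSet ι} {i : ι} (hi : i ∈ U) (m : M) : D.e i • m ∈ D.part M U :=
  fun _ hj => D.e_smul_e_smul_of_ne (fun h => hj (by rwa [h])) m

theorem part_vanishes {U : UpperSet ι} {i : ι} (hi : i ∉ U) : D.Vanishes (D.part M U) i :=
  fun m => Subtype.ext (m.2 i hi)

theorem quotient_part_vanishes {U : UpperSet ι} {i : ι} (hi : i ∈ U) :
    D.Vanishes (M ⧸ D.part M U) i := fun m => by
  obtain ⟨m, rfl⟩ := Submodule.mkQ_surjective _ m
  rw [← map_smul, Submodule.mkQ_apply, Submodule.Quotient.mk_eq_zero]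
  exact D.e_smul_mem_part hi m

theorem quotient_part_injective {y : ι} {U : UpperSet ι} (hy : y ∉ U) (x : M)
    (hx : D.e y • x = x) (h : (D.part M U).mkQ x = 0) : x = 0 := by
  rw [Submodule.mkQ_apply, Submodule.Quotient.mk_eq_zero] at h
  rw [← hx, h y hy]

/-- For equivalent indices `y` and `z`, the components of a module at `y` and `z` are identified by
elements of `A`. These are combined into families, extended by zero to the other indices. -/
theorem exists_transport (y : ι) : ∃ s t : ι → A, ∀ z, s z * D.e y = s z ∧ D.e y * t z = t z ∧
    t z * D.e z = t z ∧ (y ≤ z → z ≤ y → s z * t z = D.e z) ∧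
    (¬ (y ≤ z ∧ z ≤ y) → s z * t z = 0) ∧ (y ≤ z → z ≤ y → t z * s z = D.e y) := by
  suffices h : ∀ z, ∃ s t : A, s * D.e y = s ∧ D.e y * t = t ∧
      t * D.e z = t ∧ (y ≤ z → z ≤ y → s * t = D.e z) ∧
      (¬ (y ≤ z ∧ z ≤ y) → s * t = 0) ∧ (y ≤ z → z ≤ y → t * s = D.e y) by
    choose s t hst using h
    exact ⟨s, t, hst⟩
  intro z
  by_cases h : y ≤ z ∧ z ≤ y
  · obtain ⟨s, t, -, h2, h3, h4, h5, h6⟩ := D.exists_iso h.1 h.2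
    exact ⟨s, t, h2, h3, h4, fun _ _ => h5, fun h' => absurd h h', fun _ _ => h6⟩
  · exact ⟨0, 0, by simp, by simp, by simp, fun h1 h2 => absurd ⟨h1, h2⟩ h, by simp,
      fun h1 h2 => absurd ⟨h1, h2⟩ h⟩

/-- The module `M` vanishes outside the equivalence class of the index `y`. -/
def SupportedAt (M : Type*) [AddCommGroup M] [Module A M] (y : ι) : Prop :=
  ∀ z, ¬ (y ≤ z ∧ z ≤ y) → D.Vanishes M z

theorem SupportedAt.pow {y : ι} (h : D.SupportedAt M y) (n : ℕ) : D.SupportedAt (Fin n → M) y :=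
  fun z hz => (h z hz).pow D n

theorem SupportedAt.sum_transport {y : ι} (hM : D.SupportedAt M y) {s t : ι → A}
    (h1 : ∀ z, y ≤ z → z ≤ y → s z * t z = D.e z) (h2 : ∀ z, ¬ (y ≤ z ∧ z ≤ y) → s z * t z = 0)
    (m : M) : ∑ z, (s z * t z) • m = m := by
  conv_rhs => rw [← D.sum_smul m]
  refine Finset.sum_congr rfl fun z _ => ?_
  by_cases h : y ≤ z ∧ z ≤ y
  · rw [h1 z h.1 h.2]
  · rw [h2 z h, zero_smul, hM z h]

/-- A module supported at `y` is generated by its component at `y`. -/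
theorem SupportedAt.hom_ext {y : ι} (hM : D.SupportedAt M y) {f g : M →ₗ[A] N}
    (h : ∀ m, f (D.e y • m) = g (D.e y • m)) : f = g := by
  obtain ⟨s, t, hst⟩ := D.exists_transport y
  ext m
  rw [← hM.sum_transport D (fun z => (hst z).2.2.2.1) (fun z => (hst z).2.2.2.2.1) m, map_sum,
    map_sum]
  refine Finset.sum_congr rfl fun z _ => ?_
  rw [← (hst z).2.1, mul_smul, mul_smul, map_smul f, map_smul g, h]

end Modules

/-! ### Projective components -/

section CornerProjective

/-- The component `e y • M` is a finitely generated projective module over the corner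
`e y * A * e y`, expressed by a finite dual basis: generators `m j` and coordinate functions `f j`
(given on all of `M`; only their values on `e y • M` matter). -/
def IsCornerProjective (M : Type*) [AddCommGroup M] [Module k M] [Module A M] (y : ι) : Prop :=
  ∃ (n : ℕ) (m : Fin n → M) (f : Fin n → M →ₗ[k] A),
    (∀ j x, f j x * D.e y = f j x) ∧
    (∀ j b x, f j ((D.e y * b * D.e y) • x) = D.e y * b * D.e y * f j x) ∧
    ∀ x, D.e y • x = ∑ j, f j (D.e y • x) • m j

theorem IsCornerProjective.of_dualBasis {D : CornerData k A ι} {M : Type*} [AddCommGroup M]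
    [Module k M] [Module A M] {y : ι} {J : Type*} [Fintype J] (m : J → M) (f : J → M →ₗ[k] A)
    (h1 : ∀ j x, f j x * D.e y = f j x)
    (h2 : ∀ j b x, f j ((D.e y * b * D.e y) • x) = D.e y * b * D.e y * f j x)
    (h3 : ∀ x, D.e y • x = ∑ j, f j (D.e y • x) • m j) :
    D.IsCornerProjective M y := by
  let E := Fintype.equivFin J
  refine ⟨Fintype.card J, m ∘ E.symm, f ∘ E.symm, fun j => h1 _, fun j => h2 _, fun x => ?_⟩
  exact (h3 x).trans (E.symm.sum_comp fun j => f j (D.e y • x) • m j).symm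

theorem e_mul_apply {D : CornerData k A ι} {M : Type*} [AddCommGroup M] [Module k M]
    [Module A M] {y : ι} {f : M →ₗ[k] A}
    (h : ∀ b x, f ((D.e y * b * D.e y) • x) = D.e y * b * D.e y * f x) (x : M) :
    f (D.e y • x) = D.e y * f x := by
  simpa [D.e_mul_self] using h 1 x

theorem IsCornerProjective.pow {D : CornerData k A ι} {M : Type*} [AddCommGroup M] [Module k M]
    [Module A M] {y : ι} (hM : D.IsCornerProjective M y) (n : ℕ) :
    D.IsCornerProjective (Fin n → M) y := by
  obtain ⟨p, m, f, h1, h2, h3⟩ := hM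
  refine .of_dualBasis (J := Fin n × Fin p) (fun j => Pi.single j.1 (m j.2))
    (fun j => f j.2 ∘ₗ LinearMap.proj j.1) (fun j x => h1 _ _) (fun j b x => by simp [h2])
    fun x => ?_
  rw [Fintype.sum_prod_type]
  funext l
  rw [Finset.sum_apply, Finset.sum_eq_single l]
  · rw [Finset.sum_apply]
    simpa using h3 (x l)
  · intro i _ hi
    simp [Finset.sum_apply, Pi.single_eq_of_ne hi.symm]
  · simp

variable {M N : Type*} [AddCommGroup M] [Module k M] [Module A M] [IsScalarTower k A M]
  [AddCommGroup N] [Module k N] [Module A N] [IsScalarTower k A N]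

variable {D}

theorem IsCornerProjective.of_retract {y : ι} (i : M →ₗ[A] N) (r : N →ₗ[A] M)
    (h : ∀ m, r (i m) = m) (hN : D.IsCornerProjective N y) : D.IsCornerProjective M y := by
  obtain ⟨n, m, f, h1, h2, h3⟩ := hN
  refine ⟨n, fun j => r (m j), fun j => f j ∘ₗ i.restrictScalars k, fun j x => h1 j _,
    fun j b x => ?_, fun x => ?_⟩
  · simp [h2]
  · have := congrArg r (h3 (i x))
    simpa [h] using this

/-- Projectivity at `y` only depends on the component at `y`: it is reflected by homomorphisms
that are bijective on these components. -/
theorem IsCornerProjective.of_map {y : ι} (h : M →ₗ[A] N)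
    (hinj : ∀ x, D.e y • x = x → h x = 0 → x = 0) (hsurj : ∀ z, ∃ x, h x = D.e y • z)
    (hN : D.IsCornerProjective N y) : D.IsCornerProjective M y := by
  obtain ⟨n, m, f, h1, h2, h3⟩ := hN
  choose m' hm' using fun j => hsurj (m j)
  refine ⟨n, fun j => D.e y • m' j, fun j => f j ∘ₗ h.restrictScalars k, fun j x => h1 j _,
    fun j b x => by simp [h2], fun x => ?_⟩
  rw [← sub_eq_zero]
  apply hinj
  · rw [smul_sub, D.e_smul_e_smul, Finset.smul_sum]
    congr 1
    refine Finset.sum_congr rfl fun j _ => ?_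
    simp only [LinearMap.comp_apply, LinearMap.restrictScalars_apply, map_smul,
      e_mul_apply (h2 j), smul_smul, ← mul_assoc, D.e_mul_self]
  · rw [map_sub, map_sum, sub_eq_zero, map_smul, h3]
    refine Finset.sum_congr rfl fun j _ => ?_
    simp only [LinearMap.comp_apply, LinearMap.restrictScalars_apply, map_smul, hm', smul_smul,
      h1]

/-- Projectivity at `y` is preserved by homomorphisms that are bijective on the components
at `y`. -/
theorem IsCornerProjective.map {y : ι} (h : M →ₗ[A] N)
    (hinj : ∀ x, D.e y • x = x → h x = 0 → x = 0) (hsurj : ∀ z, ∃ x, h x = D.e y • z)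
    (hM : D.IsCornerProjective M y) : D.IsCornerProjective N y := by
  obtain ⟨n, m, f, h1, h2, h3⟩ := hM
  let eM : M →ₗ[k] M := Algebra.lsmul k k M (D.e y)
  let eN : N →ₗ[k] N := Algebra.lsmul k k N (D.e y)
  let p : M →ₗ[k] N := h.restrictScalars k ∘ₗ eM
  have hr : ∀ z, eN z ∈ LinearMap.range p := fun z => by
    obtain ⟨x, hx⟩ := hsurj z
    refine ⟨x, ?_⟩
    change h (D.e y • x) = D.e y • z
    rw [map_smul, hx, D.e_smul_e_smul]
  obtain ⟨q, hq⟩ := p.rangeRestrict.exists_rightInverse_of_surjective p.range_rangeRestrict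
  -- the `k`-linear inverse of `h` on the components at `y`
  let σ : N →ₗ[k] M := eM ∘ₗ q ∘ₗ eN.codRestrict _ hr
  have hσ : ∀ z, h (σ z) = D.e y • z := fun z =>
    congrArg Subtype.val (LinearMap.congr_fun hq (eN.codRestrict _ hr z))
  have heσ : ∀ z, D.e y • σ z = σ z := fun z => D.e_smul_e_smul _ _
  have hσb : ∀ b z, σ ((D.e y * b * D.e y) • z) = (D.e y * b * D.e y) • σ z := fun b z => by
    rw [← sub_eq_zero]
    apply hinj
    · rw [smul_sub, heσ, smul_smul, ← mul_assoc, ← mul_assoc, D.e_mul_self]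
    · rw [map_sub, map_smul h, hσ, hσ, sub_eq_zero, smul_smul, smul_smul]
      simp only [← mul_assoc, D.e_mul_self]
      simp only [mul_assoc, D.e_mul_self]
  have hσe : ∀ z, σ (D.e y • z) = D.e y • σ z := fun z => by
    simpa [D.e_mul_self] using hσb 1 z
  refine ⟨n, fun j => h (m j), fun j => f j ∘ₗ σ, fun j x => h1 j _, fun j b x => ?_, fun x => ?_⟩
  · simp only [LinearMap.comp_apply, hσb, h2]
  · have := congrArg h (h3 (σ x))
    rw [map_smul, hσ, D.e_smul_e_smul, map_sum] at this
    simpa [hσe] using this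

theorem IsCornerProjective.part {y : ι} (hM : D.IsCornerProjective M y) {U : UpperSet ι}
    (hy : y ∈ U) : D.IsCornerProjective (D.part M U) y :=
  hM.of_map (D.part M U).subtype (fun _ _ h => Subtype.ext h)
    fun z => ⟨⟨_, D.e_smul_mem_part hy z⟩, rfl⟩

theorem IsCornerProjective.quotient_part_iff {y : ι} {U : UpperSet ι} (hy : y ∉ U) :
    D.IsCornerProjective (M ⧸ D.part M U) y ↔ D.IsCornerProjective M y :=
  ⟨.of_map _ (D.quotient_part_injective hy) fun _ => Submodule.mkQ_surjective _ _,
    .map _ (D.quotient_part_injective hy) fun _ => Submodule.mkQ_surjective _ _⟩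

end CornerProjective

/-! ### Standard modules -/

/-- The projective left module `A * e y`. -/
def proj (y : ι) : Submodule A A where
  carrier := {a | a * D.e y = a}
  add_mem' ha hb := by rw [Set.mem_ofPred_eq, add_mul, ha, hb]
  zero_mem' := zero_mul _
  smul_mem' a b hb := by rw [Set.mem_ofPred_eq, smul_eq_mul, mul_assoc, hb]

theorem mem_proj {y : ι} {a : A} : a ∈ D.proj y ↔ a * D.e y = a := Iff.rfl

/-- The projection `a ↦ a * e y` of `A` onto `A * e y`. -/
def toProj (y : ι) : A →ₗ[A] D.proj y :=
  (LinearMap.toSpanSingleton A A (D.e y)).codRestrict _ fun a => by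
    rw [mem_proj, LinearMap.toSpanSingleton_apply, smul_eq_mul, mul_assoc, D.e_mul_self]

theorem toProj_coe {y : ι} (a : D.proj y) : D.toProj y a = a :=
  Subtype.ext a.2

instance (y : ι) : Module.Projective A (D.proj y) :=
  .of_split (D.proj y).subtype (D.toProj y) (LinearMap.ext D.toProj_coe)

/-- The standard module `A * e y / part (Ioi y)`: it is supported at `y`, where its component is
the corner algebra `e y * A * e y`. -/
abbrev standard (y : ι) : Type v := D.proj y ⧸ D.part (D.proj y) (UpperSet.Ioi y)

theorem proj_vanishes {y z : ι} (h : ¬ y ≤ z) : D.Vanishes (D.proj y) z := fun a => by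
  refine Subtype.ext ?_
  change D.e z * (a : A) = 0
  rw [← a.2, ← mul_assoc, D.corner_eq_zero h]

theorem standard_supportedAt (y : ι) : D.SupportedAt (D.standard y) y := fun z hz => by
  by_cases h : y ≤ z
  · exact D.quotient_part_vanishes (UpperSet.mem_Ioi_iff.2 (lt_of_le_not_ge h fun h' => hz ⟨h, h'⟩))
  · exact (D.proj_vanishes h).of_surjective D _ (Submodule.mkQ_surjective _)

theorem standard_isCornerProjective (y : ι) : D.IsCornerProjective (D.standard y) y := by
  rw [IsCornerProjective.quotient_part_iff (UpperSet.mem_Ioi_iff.not.2 (lt_irrefl y))]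
  refine .of_dualBasis (J := Unit) (fun _ => D.toProj y 1)
    (fun _ => (D.proj y).subtype.restrictScalars k) (fun _ x => x.2) (fun _ b x => rfl) fun x => ?_
  rw [Fintype.sum_unique]
  refine Subtype.ext ?_
  have : (x : A) * D.e y = x := x.2
  simp [toProj, mul_assoc, this]

section Lift

variable {M : Type*} [AddCommGroup M] [Module k M] [Module A M] [IsScalarTower k A M]

/-- The class in the standard module of the element `a * e y`. -/
def toStandard (y : ι) : A →ₗ[A] D.standard y :=
  (D.part (D.proj y) (UpperSet.Ioi y)).mkQ ∘ₗ D.toProj y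

theorem toStandard_surjective (y : ι) : Function.Surjective (D.toStandard y) :=
  (Submodule.mkQ_surjective _).comp fun a => ⟨a, D.toProj_coe a⟩

/-- The component of the standard module at `y` is the corner algebra. -/
theorem corner_eq_zero_of_toStandard {y : ι} {a : A} (h : D.toStandard y a = 0) :
    D.e y * a * D.e y = 0 := by
  have h1 : D.toProj y a ∈ D.part (D.proj y) (UpperSet.Ioi y) := by
    simpa [toStandard] using h
  have h2 := congrArg Subtype.val (h1 y (UpperSet.mem_Ioi_iff.not.2 (lt_irrefl y)))
  simpa [toProj, mul_assoc] using h2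

variable {D}

/-- Coordinate functions on the component at `y` of a module supported at `y` lift to homomorphisms
to the standard module: `m ↦ ∑ z, s z • f (t z • m)`, where `s z` and `t z` transport between the
components at `y` and `z`. -/
theorem SupportedAt.exists_lift {y : ι} (hM : D.SupportedAt M y) (f : M →ₗ[k] A)
    (hf : ∀ b x, f ((D.e y * b * D.e y) • x) = D.e y * b * D.e y * f x) :
    ∃ F : M →ₗ[A] D.standard y, ∀ x, F (D.e y • x) = D.toStandard y (f (D.e y • x)) := by
  obtain ⟨s, t, hst⟩ := D.exists_transport y
  have h1 : ∀ z, s z * D.e y = s z := fun z => (hst z).1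
  have h2 : ∀ z, D.e y * t z = t z := fun z => (hst z).2.1
  have h3 : ∀ z, t z * D.e z = t z := fun z => (hst z).2.2.1
  have h4 : ∀ z, y ≤ z → z ≤ y → s z * t z = D.e z := fun z => (hst z).2.2.2.1
  have h5 : ∀ z, ¬ (y ≤ z ∧ z ≤ y) → s z * t z = 0 := fun z => (hst z).2.2.2.2.1
  let φ : M →ₗ[k] D.standard y := (D.toStandard y).restrictScalars k ∘ₗ f
  have hφ : ∀ b x, D.e y * b * D.e y = b → φ (b • x) = b • φ x := fun b x hb => by
    have hfb := hf b x
    rw [hb] at hfb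
    change D.toStandard y (f (b • x)) = b • D.toStandard y (f x)
    rw [hfb, ← smul_eq_mul, map_smul]
  let Fk : M →ₗ[k] D.standard y :=
    ∑ z, Algebra.lsmul k k _ (s z) ∘ₗ φ ∘ₗ Algebra.lsmul k k _ (t z)
  have hFk : ∀ m, Fk m = ∑ z, s z • φ (t z • m) := fun m => by simp [Fk, LinearMap.sum_apply]
  have hlin : ∀ (a : A) m, Fk (a • m) = a • Fk m := fun a m => by
    have key : ∀ z, s z • φ (t z • a • m) = (s z * t z) • ∑ z', a • s z' • φ (t z' • m) := by
      intro z
      conv_lhs => rw [← hM.sum_transport D h4 h5 m]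
      rw [Finset.smul_sum, Finset.smul_sum, map_sum, Finset.smul_sum, Finset.smul_sum]
      refine Finset.sum_congr rfl fun z' _ => ?_
      rw [mul_smul (s z') (t z'), smul_smul a, smul_smul (t z), hφ, smul_smul, smul_smul, smul_smul]
      · congr 1
        simp only [mul_assoc]
      · rw [← mul_assoc, h2, mul_assoc, mul_assoc, h1]
    rw [hFk, Finset.sum_congr rfl fun z _ => key z,
      (D.standard_supportedAt y).sum_transport D h4 h5, hFk, Finset.smul_sum]
  refine ⟨{ Fk with map_smul' := hlin }, fun x => ?_⟩
  change Fk (D.e y • x) = φ (D.e y • x)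
  rw [hFk, Finset.sum_eq_single y]
  · rw [smul_smul, h3, hφ (t y) x (by rw [h2, h3]), smul_smul, h4 y le_rfl le_rfl,
      hφ (D.e y) x (by rw [D.e_mul_self, D.e_mul_self])]
  · intro z _ hz
    rw [smul_smul, ← h3, mul_assoc, D.e_mul_of_ne hz, mul_zero, zero_smul, map_zero, smul_zero]
  · simp

/-- A module supported at `y` with projective component is a direct summand of a power of the
standard module. -/
theorem SupportedAt.exists_retract {y : ι} (hM : D.SupportedAt M y)
    (hP : D.IsCornerProjective M y) :
    ∃ (n : ℕ) (i : M →ₗ[A] Fin n → D.standard y) (r : (Fin n → D.standard y) →ₗ[A] M),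
      ∀ m, r (i m) = m := by
  obtain ⟨n, m, f, h1, h2, h3⟩ := hP
  choose F hF using fun j => hM.exists_lift (f j) (h2 j)
  have hker : ∀ j, D.part (D.proj y) (UpperSet.Ioi y) ≤
      LinearMap.ker (LinearMap.toSpanSingleton A M (m j) ∘ₗ (D.proj y).subtype) := fun j a ha => by
    change (a : A) • m j = 0
    rw [← D.sum_smul ((a : A) • m j)]
    refine Finset.sum_eq_zero fun i _ => ?_
    by_cases hi : i ∈ UpperSet.Ioi y
    · exact hM i (fun h => not_le_of_gt (UpperSet.mem_Ioi_iff.1 hi) h.2) _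
    · have : D.e i * (a : A) = 0 := congrArg Subtype.val (ha i hi)
      rw [smul_smul, this, zero_smul]
  let G : ∀ j, D.standard y →ₗ[A] M := fun j => Submodule.liftQ _ _ (hker j)
  have hG : ∀ j a, G j (D.toStandard y a) = (a * D.e y) • m j := fun j a => by
    simp [G, toStandard, toProj]
  refine ⟨n, LinearMap.pi F, ∑ j, G j ∘ₗ LinearMap.proj j, fun x => ?_⟩
  suffices h : (∑ j, G j ∘ₗ LinearMap.proj j) ∘ₗ LinearMap.pi F = LinearMap.id from
    LinearMap.congr_fun h x
  refine hM.hom_ext D fun x => ?_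
  simp only [LinearMap.comp_apply, LinearMap.sum_apply, LinearMap.pi_apply, LinearMap.proj_apply,
    hF, hG, h1, LinearMap.id_apply]
  exact (h3 x).symm

variable (D) in
/-- The Frobenius property of the corner at `y`: for a functional `φ` on a module, the functionals
`b ↦ φ (b • x)` on the corner are represented, by means of a fixed functional `l`, by elements `c x`
of the corner, and `c` is linear over the corner. -/
theorem exists_frobenius_coordinate (M : Type*) [AddCommGroup M] [Module k M] [Module A M]
    [IsScalarTower k A M] (y : ι) :
    ∃ l : A →ₗ[k] k, ∀ φ : M →ₗ[k] k, ∃ c : M →ₗ[k] A, (∀ x, D.e y * c x * D.e y = c x) ∧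
      (∀ b x, c ((D.e y * b * D.e y) • x) = D.e y * b * D.e y * c x) ∧
      ∀ a x, l (D.e y * a * D.e y * c x) = φ ((D.e y * a * D.e y) • x) := by
  obtain ⟨p, l, U, V, hU, hV, hl1, hl2⟩ := D.exists_frobenius y
  refine ⟨l, fun φ => ?_⟩
  let c : M →ₗ[k] A := ∑ g, (φ ∘ₗ Algebra.lsmul k k M (V g)).smulRight (U g)
  have hc : ∀ x, c x = ∑ g, φ (V g • x) • U g := fun x => by simp [c, LinearMap.sum_apply]
  have hrep : ∀ a x, l (D.e y * a * D.e y * c x) = φ ((D.e y * a * D.e y) • x) := by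
    intro a x
    rw [← hl1 a, hc, Finset.sum_smul, map_sum, hl1, Finset.mul_sum, map_sum]
    refine Finset.sum_congr rfl fun g _ => ?_
    rw [mul_smul_comm, map_smul l, smul_assoc, map_smul φ, smul_eq_mul, smul_eq_mul, mul_comm]
  have hec : ∀ x, D.e y * c x * D.e y = c x := fun x => by
    rw [hc, Finset.mul_sum, Finset.sum_mul]
    exact Finset.sum_congr rfl fun g _ => by rw [mul_smul_comm, smul_mul_assoc, hU]
  refine ⟨c, hec, fun b x => ?_, hrep⟩
  -- an element of the corner is determined by its pairings under `l` with the elements `V g`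
  have h1 : D.e y * (D.e y * b * D.e y * c x) * D.e y = D.e y * b * D.e y * c x := by
    rw [← hec x]
    simp only [mul_assoc, D.e_mul_self, D.e_mul_e_mul]
  rw [← h1, ← hl2 (D.e y * b * D.e y * c x), hc ((D.e y * b * D.e y) • x)]
  refine Finset.sum_congr rfl fun g _ => ?_
  congr 1
  rw [h1, ← mul_assoc]
  have h2 : V g * (D.e y * b * D.e y) = D.e y * (V g * b) * D.e y := by
    rw [← hV g]
    simp only [mul_assoc, D.e_mul_e_mul]
  rw [h2, hrep, ← h2, smul_smul]

/-- A finite-dimensional module supported at `y` embeds into a power of the standard module, because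
the corner algebra, being Frobenius, cogenerates its finite-dimensional modules. -/
theorem SupportedAt.exists_embedding [Module.Finite k M] {y : ι} (hM : D.SupportedAt M y) :
    ∃ (n : ℕ) (i : M →ₗ[A] Fin n → D.standard y), Function.Injective i := by
  obtain ⟨l, h⟩ := D.exists_frobenius_coordinate M y
  choose c hec hlin hrep using h
  choose F hF using fun φ => hM.exists_lift (c φ) (hlin φ)
  let B := Module.finBasis k (Module.Dual k M)
  refine ⟨_, LinearMap.pi fun j => F (B j), ?_⟩
  rw [injective_iff_map_eq_zero]
  intro x hx
  obtain ⟨s, t, hst⟩ := D.exists_transport y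
  rw [← hM.sum_transport D (fun z => (hst z).2.2.2.1) (fun z => (hst z).2.2.2.2.1) x]
  refine Finset.sum_eq_zero fun z _ => ?_
  suffices h : t z • x = 0 by rw [mul_smul, h, smul_zero]
  rw [← Module.forall_dual_apply_eq_zero_iff k]
  suffices h : ∀ j, B j (t z • x) = 0 by
    intro φ
    rw [← B.sum_repr φ, LinearMap.sum_apply]
    exact Finset.sum_eq_zero fun j _ => by rw [LinearMap.smul_apply, h, smul_zero]
  intro j
  have h1 : F (B j) (D.e y • t z • x) = 0 := by
    have : F (B j) x = 0 := congrFun hx j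
    rw [map_smul, map_smul, this, smul_zero, smul_zero]
  rw [hF] at h1
  have h2 := D.corner_eq_zero_of_toStandard h1
  rw [hec, smul_smul, (hst z).2.1] at h2
  have h3 := hrep (B j) 1 (t z • x)
  rw [h2, mul_zero, map_zero, mul_one, D.e_mul_self, smul_smul, (hst z).2.1] at h3
  exact h3.symm

end Lift

end CornerData

variable {k : Type w} [Field k] {A : Type v} [Ring A] [Algebra k A]
  {ι : Type u} [Fintype ι] [Preorder ι] (D : CornerData k A ι)

/-! ### Modules with projective components are generated by the projectives `A * e y` -/

theorem IsThick.standard {Φ : ModuleFamily k A} (hΦ : IsThick Φ) {y : ι} (h : Φ (D.proj y))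
    (h' : Φ (D.part (D.proj y) (UpperSet.Ioi y))) : Φ (D.standard y) :=
  hΦ.of_coker _ _ (Submodule.injective_subtype _) (Submodule.mkQ_surjective _)
    (LinearMap.exact_subtype_mkQ _) h' h

/-- Suppose that the components of the regular module at all indices of an upper set `U` are
projective. Then a module supported on `U` with projective components lies in every thick family
that contains the projectives `A * e y` for `y ∈ U`. For a minimal `y ∈ U`, the module is an
extension of a summand of a power of the standard module at `y` by a module with smaller support,
and the standard module is the quotient of `A * e y` by another one with smaller support. -/
theorem IsThick.of_isCornerProjective {Φ : ModuleFamily k A} (hΦ : IsThick Φ) (U : UpperSet ι)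
    (hproj : ∀ y ∈ U, Φ (D.proj y)) (hA : ∀ y ∈ U, D.IsCornerProjective A y)
    (K : Type v) [AddCommGroup K] [Module k K] [Module A K] [IsScalarTower k A K]
    (hK : ∀ i ∉ U, D.Vanishes K i) (hKP : ∀ y ∈ U, D.IsCornerProjective K y) : Φ K := by
  induction hn : (U : Set ι).ncard using Nat.strong_induction_on generalizing U K with
  | _ n ih =>
    subst hn
    by_cases hU : (U : Set ι).Nonempty
    · obtain ⟨y, hy, hmin⟩ := (U : Set ι).toFinite.exists_minimal hU
      have hyU : y ∈ U := hy
      have hIoi : UpperSet.Ioi y ≥ U := fun z hz => U.upper (UpperSet.mem_Ioi_iff.1 hz).le hyU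
      let U' : UpperSet ι := ⟨{z | z ∈ U ∧ ¬ z ≤ y}, fun a b hab ha =>
        ⟨U.upper hab ha.1, fun hb => ha.2 (hab.trans hb)⟩⟩
      have hU' : ∀ z, z ∈ U' ↔ z ∈ U ∧ ¬ z ≤ y := fun _ => Iff.rfl
      have hS : Φ (D.standard y) := by
        refine hΦ.standard D (hproj y hyU) (ih _ ?_ (UpperSet.Ioi y)
          (fun z hz => hproj z (hIoi hz)) (fun z hz => hA z (hIoi hz)) _
          (fun i hi => D.part_vanishes hi) (fun z hz => ?_) rfl)
        · refine Set.ncard_lt_ncard ⟨hIoi, fun h => ?_⟩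
          exact lt_irrefl y (h hyU)
        · exact .part (.of_retract (D.proj y).subtype (D.toProj y) D.toProj_coe (hA z (hIoi hz))) hz
      have hlt : (U' : Set ι).ncard < (U : Set ι).ncard :=
        Set.ncard_lt_ncard ⟨fun z hz => hz.1, fun h => (h hyU).2 le_rfl⟩
      have hsub : Φ (D.part K U') :=
        ih _ hlt U' (fun z hz => hproj z hz.1) (fun z hz => hA z hz.1) _
          (fun i hi => D.part_vanishes hi) (fun z hz => (hKP z hz.1).part hz) rfl
      have hsupp : D.SupportedAt (K ⧸ D.part K U') y := fun z hz => by
        by_cases hzU : z ∈ U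
        · exact D.quotient_part_vanishes ((hU' z).2 ⟨hzU, fun h => hz ⟨hmin hzU h, h⟩⟩)
        · exact (hK z hzU).of_surjective D _ (Submodule.mkQ_surjective _)
      obtain ⟨n, i, r, hir⟩ := hsupp.exists_retract
        ((CornerData.IsCornerProjective.quotient_part_iff (U := U') fun h => h.2 le_rfl).2
          (hKP y hyU))
      exact hΦ.of_ext _ _ (Submodule.injective_subtype _) (Submodule.mkQ_surjective _)
        (LinearMap.exact_subtype_mkQ _) hsub
        (hΦ.of_retract i r hir (ModuleFamily.pow hΦ.of_subsingleton hΦ.of_ext hS n))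
    · have : Subsingleton K := by
        refine subsingleton_of_forall_eq 0 fun m => ?_
        rw [← D.sum_smul m]
        exact Finset.sum_eq_zero fun i _ => hK i (fun hi => hU ⟨i, hi⟩) m
      exact hΦ.of_subsingleton K

/-! ### Finite injective dimension implies projective components -/

namespace CornerData

variable {D}

theorem finite_quotient {M : Type*} [AddCommGroup M] [Module k M] [Module A M]
    [IsScalarTower k A M] [Module.Finite k M] (N : Submodule A M) : Module.Finite k (M ⧸ N) :=
  Module.Finite.of_surjective (N.mkQ.restrictScalars k) N.mkQ_surjective

instance [Module.Finite k A] (y : ι) : Module.Finite k (D.standard y) :=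
  Module.Finite.of_surjective ((D.toStandard y).restrictScalars k) (D.toStandard_surjective y)

/-- If `F` has finite injective dimension and the standard module at `y` has no higher extensions
by `F`, then no finite-dimensional module supported at `y` has: such a module is an iterated syzygy
relative to powers of the standard module. -/
theorem SupportedAt.extVanishes [Module.Finite k A] {y : ι} {F : Type v} [AddCommGroup F]
    [Module A F] (hF : HasFiniteInjectiveDimension A F)
    (hS : ∀ i, ExtVanishes A (i + 1) (D.standard y) F)
    {Q : Type v} [AddCommGroup Q] [Module k Q] [Module A Q] [IsScalarTower k A Q]
    [Module.Finite k Q] (hQ : D.SupportedAt Q y) (i : ℕ) : ExtVanishes A (i + 1) Q F := by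
  obtain ⟨N, hN⟩ := hF
  obtain ⟨d, hd⟩ : ∃ d, N ≤ i + 1 + d := ⟨N, Nat.le_add_left _ _⟩
  induction d generalizing i Q with
  | zero => exact fun e => e.eq_zero_of_hasInjectiveDimensionLT N hd
  | succ d ih =>
    obtain ⟨n, f, hf⟩ := hQ.exists_embedding
    have hpow : ∀ i, ExtVanishes A (i + 1) (Fin n → D.standard y) F :=
      ModuleFamily.pow (k := k) (Φ := fun M _ _ _ _ => ∀ i, ExtVanishes A (i + 1) M F)
        (fun _ _ _ _ _ _ _ => .of_subsingleton _)
        (fun _ _ hf hg hfg hX hZ i => .of_ext hf hg hfg (hX i) (hZ i)) hS n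
    have hsurj := Submodule.mkQ_surjective (LinearMap.range f)
    have hC : D.SupportedAt ((Fin n → D.standard y) ⧸ LinearMap.range f) y := fun z hz =>
      ((D.standard_supportedAt y).pow D n z hz).of_surjective D _ hsurj
    have : Module.Finite k ((Fin n → D.standard y) ⧸ LinearMap.range f) := finite_quotient _
    exact .of_ker hf hsurj f.exact_map_mkQ_range (hpow i) (ih hC (i + 1) (by omega))

/-- If the regular module has finite injective dimension, then all its components are projective.
By induction, the components at indices above `y` are projective. Dividing out the part `U` of the
regular module above `y` gives a module `F` which still has finite injective dimension, and the
higher extensions of the standard module at `y` by `F` vanish. Hence the submodule of `F` supported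
at `y`, once embedded into a power of the standard module, splits off. -/
theorem isCornerProjective_of_hasFiniteInjectiveDimension [Module.Finite k A]
    (hA : HasFiniteInjectiveDimension A A) (y : ι) : D.IsCornerProjective A y := by
  induction y using WellFoundedGT.induction with
  | _ y ih =>
    have ih' : ∀ z ∈ UpperSet.Ioi y, D.IsCornerProjective A z :=
      fun z hz => ih z (UpperSet.mem_Ioi_iff.1 hz)
    have hy : y ∉ UpperSet.Ioi y := UpperSet.mem_Ioi_iff.not.2 (lt_irrefl y)
    let F := A ⧸ D.part A (UpperSet.Ioi y)
    have hF : HasFiniteInjectiveDimension A F := by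
      refine .of_coker _ _ (Submodule.injective_subtype _) (Submodule.mkQ_surjective _)
        (LinearMap.exact_subtype_mkQ _) ?_ hA
      exact (isThick_hasFiniteInjectiveDimension (k := k)).of_isCornerProjective D (UpperSet.Ioi y)
        (fun z _ => .of_retract (D.proj z).subtype (D.toProj z) D.toProj_coe hA) ih' _
        (fun i hi => D.part_vanishes hi) fun z hz => (ih' z hz).part hz
    have hproj : ∀ z ∈ UpperSet.Ioi y, ∀ i, ExtVanishes A i (D.proj z) F := fun z hz i => by
      cases i with
      | zero =>
        rw [ExtVanishes.zero_iff]
        intro f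
        ext a
        have h1 : a = (a : A) • D.toProj z (D.e z) := by
          rw [← map_smul, smul_eq_mul, show (a : A) * D.e z = a from a.2, D.toProj_coe]
        have h2 : D.toProj z (D.e z) = D.e z • D.toProj z 1 := by
          rw [← map_smul, smul_eq_mul, mul_one]
        rw [h1, h2, map_smul, map_smul, D.quotient_part_vanishes hz, smul_zero,
          LinearMap.zero_apply]
      | succ i => exact .of_projective i
    have hS : ∀ i, ExtVanishes A (i + 1) (D.standard y) F := fun i => by
      refine .of_coker_succ (Submodule.injective_subtype _) (Submodule.mkQ_surjective _)
        (LinearMap.exact_subtype_mkQ _) ?_ (.of_projective i)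
      refine (isThick_extVanishes (k := k) F).of_isCornerProjective D (UpperSet.Ioi y)
        hproj ih' _ (fun i hi => D.part_vanishes hi) (fun z hz => .part ?_ hz) i
      exact .of_retract (D.proj y).subtype (D.toProj y) D.toProj_coe (ih' z hz)
    -- the submodule of `F` supported at `y`
    let M := D.part F (UpperSet.Ici y)
    have hM : D.SupportedAt M y := fun z hz => by
      by_cases h : y ≤ z
      · exact Vanishes.of_injective D (D.quotient_part_vanishes
          (UpperSet.mem_Ioi_iff.2 (lt_of_le_not_ge h fun h' => hz ⟨h, h'⟩))) _
          (Submodule.injective_subtype _)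
      · exact D.part_vanishes (UpperSet.mem_Ici_iff.not.2 h)
    have : Module.Finite k F := finite_quotient _
    have : Module.Finite k M :=
      Module.Finite.of_injective (M.subtype.restrictScalars k) (Submodule.injective_subtype _)
    obtain ⟨n, f, hf⟩ := hM.exists_embedding
    have hsupp := (D.standard_supportedAt y).pow D n
    have hsurj := Submodule.mkQ_surjective (LinearMap.range f)
    have : Module.Finite k ((Fin n → D.standard y) ⧸ LinearMap.range f) := finite_quotient _
    have hC : D.SupportedAt ((Fin n → D.standard y) ⧸ LinearMap.range f) y := fun z hz =>
      (hsupp z hz).of_surjective D _ hsurj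
    obtain ⟨r, hr⟩ := ExtVanishes.exists_extension hf hsurj f.exact_map_mkQ_range
      (hC.extVanishes hF hS 0) M.subtype
    have hrM : ∀ x, r x ∈ M := fun x i hi => by
      rw [← map_smul, hsupp i (fun h => hi (UpperSet.mem_Ici_iff.2 h.1)), map_zero]
    have hMP : D.IsCornerProjective M y :=
      .of_retract f (r.codRestrict M hrM) (fun m => Subtype.ext (hr m))
        ((D.standard_isCornerProjective y).pow n)
    rw [← IsCornerProjective.quotient_part_iff hy]
    exact hMP.map M.subtype (fun _ _ h => Subtype.ext h)
      fun z => ⟨⟨_, D.e_smul_mem_part (UpperSet.mem_Ici_iff.2 le_rfl) z⟩, rfl⟩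

end CornerData

/-! ### Duality between left and right modules -/

section Duality

variable (k : Type w) [Field k] (A : Type v) [Ring A] [Algebra k A]

/-- The `k`-dual of a left `A`-module, as a right `A`-module: `(φ · a) m = φ (a • m)`. -/
def LeftDual (M : Type*) [AddCommGroup M] [Module k M] : Type _ := M →ₗ[k] k

/-- The `k`-dual of the right regular module, as a left `A`-module: `(a • φ) x = φ (x * a)`. -/
def RegularDual : Type _ := A →ₗ[k] k

variable {A}

section

variable {M N : Type*} [AddCommGroup M] [Module k M] [Module A M] [IsScalarTower k A M]
  [AddCommGroup N] [Module k N] [Module A N] [IsScalarTower k A N]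

instance : AddCommGroup (LeftDual k M) := inferInstanceAs (AddCommGroup (M →ₗ[k] k))

instance : FunLike (LeftDual k M) M k := inferInstanceAs (FunLike (M →ₗ[k] k) M k)

instance : LinearMapClass (LeftDual k M) k M k :=
  inferInstanceAs (LinearMapClass (M →ₗ[k] k) k M k)

instance : AddCommGroup (RegularDual k A) := inferInstanceAs (AddCommGroup (A →ₗ[k] k))

instance : Module k (RegularDual k A) := inferInstanceAs (Module k (A →ₗ[k] k))

instance : FunLike (RegularDual k A) A k := inferInstanceAs (FunLike (A →ₗ[k] k) A k)

instance : LinearMapClass (RegularDual k A) k A k :=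
  inferInstanceAs (LinearMapClass (A →ₗ[k] k) k A k)

variable {k}

namespace LeftDual

/-- A functional on a left module, as an element of its dual. -/
def of (φ : M →ₗ[k] k) : LeftDual k M := φ

theorem ext {φ ψ : LeftDual k M} (h : ∀ m, φ m = ψ m) : φ = ψ := LinearMap.ext h

theorem add_apply (φ ψ : LeftDual k M) (m : M) : (φ + ψ) m = φ m + ψ m := rfl

instance : SMul Aᵐᵒᵖ (LeftDual k M) where
  smul a φ := of (LinearMap.comp (show M →ₗ[k] k from φ) (Algebra.lsmul k k M a.unop))

theorem smul_apply (a : Aᵐᵒᵖ) (φ : LeftDual k M) (m : M) : (a • φ) m = φ (a.unop • m) := rfl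

instance : Module Aᵐᵒᵖ (LeftDual k M) where
  one_smul φ := ext fun m => by simp [smul_apply]
  mul_smul a b φ := ext fun m => by simp [smul_apply, mul_smul]
  smul_zero _ := rfl
  smul_add _ _ _ := rfl
  add_smul a b φ := ext fun m => by simp [smul_apply, add_smul, add_apply]
  zero_smul φ := ext fun m => by
    rw [smul_apply, MulOpposite.unop_zero, zero_smul, map_zero]
    rfl

/-- The transpose of a homomorphism of left modules. -/
def map (f : M →ₗ[A] N) : LeftDual k N →ₗ[Aᵐᵒᵖ] LeftDual k M where
  toFun φ := of (LinearMap.comp (show N →ₗ[k] k from φ) (f.restrictScalars k))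
  map_add' _ _ := rfl
  map_smul' a φ := ext fun m => congrArg φ (map_smul f a.unop m).symm

theorem map_apply (f : M →ₗ[A] N) (φ : LeftDual k N) (m : M) : map f φ m = φ (f m) := rfl

theorem map_injective (f : M →ₗ[A] N) (hf : Function.Surjective f) :
    Function.Injective (map (k := k) f) := fun φ ψ h => ext fun n => by
  obtain ⟨m, rfl⟩ := hf n
  exact congrArg (fun χ : LeftDual k M => χ m) h

theorem map_surjective (f : M →ₗ[A] N) (hf : Function.Injective f) :
    Function.Surjective (map (k := k) f) :=
  LinearMap.dualMap_surjective_of_injective (f := f.restrictScalars k) hf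

theorem map_exact {L : Type*} [AddCommGroup L] [Module k L] [Module A L]
    [IsScalarTower k A L] (f : L →ₗ[A] M) (g : M →ₗ[A] N) (hg : Function.Surjective g)
    (hfg : Function.Exact f g) : Function.Exact (map (k := k) g) (map (k := k) f) := by
  intro φ
  constructor
  · intro h
    obtain ⟨s, hs⟩ := (g.restrictScalars k).exists_rightInverse_of_surjective
      (LinearMap.range_eq_top.2 hg)
    have hs' : ∀ n, g (s n) = n := fun n => LinearMap.congr_fun hs n
    refine ⟨of (LinearMap.comp (show M →ₗ[k] k from φ) s), ext fun m => ?_⟩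
    change φ (s (g m)) = φ m
    have h1 : g (s (g m) - m) = 0 := by rw [map_sub, hs', sub_self]
    obtain ⟨x, hx⟩ := (hfg _).1 h1
    have h2 : φ (f x) = 0 := congrArg (fun χ : LeftDual k L => χ x) h
    rwa [hx, map_sub, sub_eq_zero] at h2
  · rintro ⟨ψ, rfl⟩
    refine ext fun x => ?_
    rw [map_apply, map_apply, hfg.apply_apply_eq_zero, map_zero]
    rfl

end LeftDual

namespace RegularDual

/-- A functional on the algebra, as an element of the dual of the right regular module. -/
def of (φ : A →ₗ[k] k) : RegularDual k A := φ

theorem ext {φ ψ : RegularDual k A} (h : ∀ x, φ x = ψ x) : φ = ψ := LinearMap.ext h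

theorem add_apply (φ ψ : RegularDual k A) (x : A) : (φ + ψ) x = φ x + ψ x := rfl

theorem base_smul_apply (r : k) (φ : RegularDual k A) (x : A) : (r • φ) x = r * φ x := rfl

variable (k) in
/-- Evaluation at an element of the algebra. -/
def eval (x : A) : RegularDual k A →ₗ[k] k where
  toFun φ := φ x
  map_add' _ _ := rfl
  map_smul' _ _ := rfl

theorem eval_apply (x : A) (φ : RegularDual k A) : eval k x φ = φ x := rfl

instance : SMul A (RegularDual k A) where
  smul a φ := of (LinearMap.comp (show A →ₗ[k] k from φ) (LinearMap.mulRight k a))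

theorem smul_apply (a : A) (φ : RegularDual k A) (x : A) : (a • φ) x = φ (x * a) := rfl

instance : Module A (RegularDual k A) where
  one_smul φ := ext fun x => by simp [smul_apply]
  mul_smul a b φ := ext fun x => by simp [smul_apply, mul_assoc]
  smul_zero _ := rfl
  smul_add _ _ _ := rfl
  add_smul a b φ := ext fun x => by simp [smul_apply, mul_add, add_apply]
  zero_smul φ := ext fun x => by
    rw [smul_apply, mul_zero, map_zero]
    rfl

instance : IsScalarTower k A (RegularDual k A) where
  smul_assoc r a φ := ext fun x => by simp [smul_apply, base_smul_apply]

end RegularDual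

end

/-- The dual of the left regular module is an injective right module: a homomorphism from a right
ideal to it amounts to a functional on that right ideal, which extends to the whole algebra. -/
instance : Module.Injective Aᵐᵒᵖ (LeftDual k A) := by
  refine Module.Baer.injective fun I g => ?_
  let g₁ : I.restrictScalars k →ₗ[k] k :=
    { toFun := fun x => g ⟨x.1, x.2⟩ 1
      map_add' := fun x y =>
        congrArg (fun χ : LeftDual k A => χ 1) (map_add g ⟨x.1, x.2⟩ ⟨y.1, y.2⟩)
      map_smul' := fun r x => by
        have h1 : (⟨(r • x).1, (r • x).2⟩ : I) = algebraMap k Aᵐᵒᵖ r • ⟨x.1, x.2⟩ :=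
          Subtype.ext (Algebra.smul_def r x.1)
        rw [h1, map_smul, LeftDual.smul_apply, MulOpposite.algebraMap_apply,
          MulOpposite.unop_op, smul_eq_mul, ← Algebra.smul_def, map_smul]
        rfl }
  have hg₁ : ∀ x (hx : x ∈ I), g₁ ⟨x, hx⟩ = g ⟨x, hx⟩ 1 := fun _ _ => rfl
  obtain ⟨ψ, hψ⟩ := g₁.exists_extend
  have hψ' : ∀ x (hx : x ∈ I), ψ x = g ⟨x, hx⟩ 1 := fun x hx =>
    LinearMap.congr_fun hψ (⟨x, hx⟩ : I.restrictScalars k)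
  let G : Aᵐᵒᵖ → LeftDual k A := fun y => LeftDual.of
    (ψ ∘ₗ LinearMap.mulRight k y ∘ₗ (MulOpposite.opLinearEquiv k).toLinearMap)
  have hG : ∀ y n, G y n = ψ (.op n * y) := fun _ _ => rfl
  refine ⟨{ toFun := G, map_add' := fun x y => ?_, map_smul' := fun a y => ?_ }, fun x hx => ?_⟩
  · exact LeftDual.ext fun n => by rw [LeftDual.add_apply, hG, hG, hG, mul_add, map_add]
  · refine LeftDual.ext fun n => ?_
    rw [RingHom.id_apply, LeftDual.smul_apply, hG, hG, smul_eq_mul, smul_eq_mul, MulOpposite.op_mul,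
      MulOpposite.op_unop, mul_assoc]
  · refine LeftDual.ext fun n => ?_
    change ψ (.op n * x) = _
    have h1 : (⟨MulOpposite.op n * x, I.mul_mem_left _ hx⟩ : I) = MulOpposite.op n • ⟨x, hx⟩ := rfl
    rw [hψ' _ (I.mul_mem_left _ hx), h1, map_smul, LeftDual.smul_apply, MulOpposite.unop_op,
      smul_eq_mul, mul_one]

theorem isThick_leftDual :
    IsThick (k := k) (A := A) fun M _ _ _ _ => HasFiniteInjectiveDimension Aᵐᵒᵖ (LeftDual k M) where
  of_subsingleton M _ _ _ _ _ :=
    have : Subsingleton (LeftDual k M) := inferInstanceAs (Subsingleton (M →ₗ[k] k))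
    .of_subsingleton
  of_retract i r h hN := hN.of_retract (LeftDual.map r) (LeftDual.map i) fun φ =>
    LeftDual.ext fun m => congrArg φ (h m)
  of_ext f g hf hg hfg hX hZ := .of_ext _ _ (LeftDual.map_injective g hg)
    (LeftDual.map_surjective f hf) (LeftDual.map_exact f g hg hfg) hZ hX
  of_coker f g hf hg hfg hX hY := .of_ker _ _ (LeftDual.map_injective g hg)
    (LeftDual.map_surjective f hf) (LeftDual.map_exact f g hg hfg) hY hX

end Duality

/-! ### Projective components imply finite injective dimension -/

namespace CornerData

section

variable {k : Type w} [Field k] {A : Type v} [Ring A] [Algebra k A]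
  {ι : Type u} [Fintype ι] [Preorder ι] {D : CornerData k A ι}

/-- If the component `A * e y` of the right regular module is projective over the corner at `y`,
then so is the component at `y` of its dual, because the corner is Frobenius. -/
theorem isCornerProjective_regularDual {y : ι}
    (h : D.op.IsCornerProjective Aᵐᵒᵖ (OrderDual.toDual y)) :
    D.IsCornerProjective (RegularDual k A) y := by
  obtain ⟨n, m, f, h1, h2, h3⟩ := h
  obtain ⟨l, hl⟩ := D.exists_frobenius_coordinate (RegularDual k A) y
  choose c hec hlin hrep using fun j : Fin n =>
    hl (RegularDual.eval k (m j).unop)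
  let f' : Fin n → A →ₗ[k] A := fun j => (MulOpposite.opLinearEquiv k).symm.toLinearMap ∘ₗ f j ∘ₗ
    (MulOpposite.opLinearEquiv k).toLinearMap
  have h1' : ∀ j x, D.e y * f' j x = f' j x := fun j x => congrArg MulOpposite.unop (h1 j (.op x))
  have h2' : ∀ j b x, f' j (x * (D.e y * b * D.e y)) = f' j x * (D.e y * b * D.e y) :=
    fun j b x => by
      have := congrArg MulOpposite.unop (h2 j (.op b) (.op x))
      simpa [f', op, mul_assoc] using this
  have h3' : ∀ x, x * D.e y = ∑ j, (m j).unop * f' j (x * D.e y) := fun x => by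
    have := congrArg MulOpposite.unop (h3 (.op x))
    simpa [f', op, Finset.unop_sum] using this
  have h2e : ∀ j x, f' j (x * D.e y) = f' j x * D.e y := fun j x => by
    simpa [D.e_mul_self] using h2' j 1 x
  refine ⟨n, fun j => .of (l ∘ₗ f' j), c, fun j x => ?_, hlin, fun φ => RegularDual.ext fun x => ?_⟩
  · rw [← hec j x, mul_assoc, D.e_mul_self]
  · have hsum : ∀ a : Fin n → A, (∑ j, a j • RegularDual.of (l ∘ₗ f' j)) x =
        ∑ j, l (f' j (x * a j)) := fun a => by
      rw [← RegularDual.eval_apply, map_sum]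
      rfl
    rw [RegularDual.smul_apply, h3', map_sum, hsum]
    refine Finset.sum_congr rfl fun j _ => ?_
    have h4 := hrep j (f' j x) φ
    rw [RegularDual.eval_apply, RegularDual.smul_apply, h1'] at h4
    have h5 : c j (D.e y • φ) = D.e y * c j φ * D.e y := by
      rw [e_mul_apply (hlin j), ← hec j φ]
      simp only [mul_assoc, D.e_mul_self, D.e_mul_e_mul]
    have h6 : D.e y * c j φ = c j φ := by
      rw [← hec j φ]
      simp only [mul_assoc, D.e_mul_e_mul]
    rw [h5, h2', h2e, ← h4, hec, mul_assoc, h6]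

end

section

variable {k : Type w} [Field k] {A : Type (max w v)} [Ring A] [Algebra k A]
  {ι : Type u} [Fintype ι] [Preorder ι] {D : CornerData k A ι}

/-- If the components of the left and of the right regular module are projective, then the right
regular module has finite injective dimension: it is dual to a left module with projective
components, which is built from the projectives `A * e y`, and these have injective duals. -/
theorem hasFiniteInjectiveDimension_of_isCornerProjective [Module.Finite k A]
    (hl : ∀ y, D.IsCornerProjective A y) (hr : ∀ y, D.op.IsCornerProjective Aᵐᵒᵖ y) :
    HasFiniteInjectiveDimension Aᵐᵒᵖ A := by
  have hΦ := isThick_leftDual.{w, max w v} (k := k) (A := A)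
  have h := hΦ.of_isCornerProjective D ⊥
    (fun y _ => hΦ.of_retract (D.proj y).subtype (D.toProj y) D.toProj_coe .of_injective)
    (fun y _ => hl y) (RegularDual k A) (fun i hi => absurd (UpperSet.mem_bot) hi)
    fun y _ => isCornerProjective_regularDual (hr y)
  -- the regular module is its own double dual
  let E : A ≃ₗ[k] Module.Dual k (Module.Dual k A) := Module.evalEquiv k A
  let ev : A →ₗ[Aᵐᵒᵖ] LeftDual k (RegularDual k A) :=
    { toFun := fun x => LeftDual.of (RegularDual.eval k x)
      map_add' := fun x y => LeftDual.ext fun φ => map_add φ x y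
      map_smul' := fun a x => rfl }
  have hev : Function.Bijective ev := E.bijective
  let ev' := LinearEquiv.ofBijective ev hev
  exact h.of_retract ev'.toLinearMap ev'.symm.toLinearMap ev'.symm_apply_apply

theorem IsCornerProjective.op_op {y : ι} (h : D.IsCornerProjective A y) :
    D.op.op.IsCornerProjective Aᵐᵒᵖᵐᵒᵖ (OrderDual.toDual (OrderDual.toDual y)) := by
  obtain ⟨n, m, f, h1, h2, h3⟩ := h
  let E : A ≃ₗ[k] Aᵐᵒᵖᵐᵒᵖ := MulOpposite.opLinearEquiv k ≪≫ₗ MulOpposite.opLinearEquiv k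
  refine ⟨n, fun j => E (m j), fun j => E.toLinearMap ∘ₗ f j ∘ₗ E.symm.toLinearMap,
    fun j x => ?_, fun j b x => ?_, fun x => ?_⟩
  · exact congrArg E (h1 j (E.symm x))
  · exact congrArg E (h2 j (E.symm b) (E.symm x))
  · refine (congrArg E (h3 (E.symm x))).trans ?_
    rw [map_sum]
    rfl

/-- If the components of the left and of the right regular module are projective, then the left
regular module has finite injective dimension. -/
theorem hasFiniteInjectiveDimension_left [Module.Finite k A]
    (hl : ∀ y, D.IsCornerProjective A y) (hr : ∀ y, D.op.IsCornerProjective Aᵐᵒᵖ y) :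
    HasFiniteInjectiveDimension A A := by
  have h := hasFiniteInjectiveDimension_of_isCornerProjective.{w, v} (D := D.op) hr
    fun y => (hl y).op_op
  rw [hasFiniteInjectiveDimension_iff] at h ⊢
  have := RingHomInvPair.of_ringEquiv (RingEquiv.opOp A)
  have := RingHomInvPair.of_ringEquiv (RingEquiv.opOp A).symm
  have e : A ≃ₛₗ[RingHomClass.toRingHom (RingEquiv.opOp A)] Aᵐᵒᵖ :=
    { MulOpposite.opAddEquiv with map_smul' := fun a x => rfl }
  rwa [ModuleCat.injectiveDimension_eq_of_semiLinearEquiv (M := ModuleCat.of A A)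
    (N := ModuleCat.of Aᵐᵒᵖᵐᵒᵖ Aᵐᵒᵖ) (RingEquiv.opOp A) e]

end

end CornerData

/-! ### Projectivity over a ring identified with a corner -/

namespace CornerData

variable {k : Type w} [Field k] {A : Type*} [Ring A] [Algebra k A]
  {ι : Type*} [Fintype ι] [Preorder ι] {D : CornerData k A ι}

/-- Suppose that `γ` identifies a ring `B` with the corner `e y * A * e y`, with inverse induced by
`γ'`, and that the component `e y * A` of the regular module is the direct sum of `B`-modules `P x`,
with inclusions `ρ x` and projections `π x`. Then projectivity of this component amounts to
projectivity of all the `P x`. -/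
theorem isCornerProjective_iff {y : ι} {B κ : Type*} [Ring B] [Algebra k B] [Fintype κ]
    {P : κ → Type*} [∀ x, AddCommGroup (P x)] [∀ x, Module k (P x)] [∀ x, Module B (P x)]
    [∀ x, Module.Finite k (P x)] (γ : B →ₗ[k] A) (γ' : A →ₗ[k] B) (ρ : ∀ x, P x →ₗ[k] A)
    (π : ∀ x, A →ₗ[k] P x) (γ_one : γ 1 = D.e y) (γ_mul : ∀ b b', γ (b * b') = γ b * γ b')
    (γ_γ' : ∀ a, γ (γ' a) = D.e y * a * D.e y) (γ'_γ : ∀ b, γ' (γ b) = b)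
    (ρ_smul : ∀ x b p, ρ x (b • p) = γ b * ρ x p) (π_mul : ∀ x b a, π x (γ b * a) = b • π x a)
    (π_ρ : ∀ x p, π x (ρ x p) = p) (sum_ρ : ∀ a, ∑ x, ρ x (π x a) = D.e y * a) :
    D.IsCornerProjective A y ↔ ∀ x, Module.Projective B (P x) := by
  have hγe : ∀ b, γ b * D.e y = γ b := fun b => by rw [← γ_one, ← γ_mul, mul_one]
  have heγ : ∀ b, D.e y * γ b = γ b := fun b => by rw [← γ_one, ← γ_mul, one_mul]
  have heρ : ∀ x p, D.e y * ρ x p = ρ x p := fun x p => by rw [← γ_one, ← ρ_smul, one_smul]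
  constructor
  · rintro ⟨n, m, f, h1, h2, h3⟩ x
    have hfρ : ∀ j p, γ (γ' (f j (ρ x p))) = f j (ρ x p) := fun j p => by
      rw [γ_γ', mul_assoc, h1, ← e_mul_apply (h2 j), smul_eq_mul, heρ]
    have hlin : ∀ j b p, γ' (f j (ρ x (b • p))) = b • γ' (f j (ρ x p)) := fun j b p => by
      have h4 := h2 j (γ b) (ρ x p)
      rw [heγ, hγe, smul_eq_mul] at h4
      rw [ρ_smul, h4, ← hfρ, ← γ_mul, γ'_γ, γ'_γ, smul_eq_mul]
    refine Module.Projective.of_split (M := Fin n → B)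
      (LinearMap.pi fun j => { toFun := fun p => γ' (f j (ρ x p))
                               map_add' := fun p q => by simp only [map_add]
                               map_smul' := hlin j })
      (∑ j, LinearMap.toSpanSingleton B _ (π x (m j)) ∘ₗ LinearMap.proj j) ?_
    ext p
    rw [LinearMap.comp_apply, LinearMap.sum_apply, LinearMap.id_apply]
    have h5 := congrArg (π x) (h3 (ρ x p))
    rw [smul_eq_mul, heρ, π_ρ, map_sum] at h5
    refine Eq.trans (Finset.sum_congr rfl fun j _ => ?_) h5.symm
    rw [← hfρ, smul_eq_mul, π_mul]
    rfl
  · intro hP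
    have htower : ∀ x, IsScalarTower k B (P x) := fun x => ⟨fun r b p => by
      rw [← π_ρ x ((r • b) • p), ← π_ρ x (r • b • p)]
      congr 1
      rw [ρ_smul, map_smul, map_smul, ρ_smul, smul_mul_assoc]⟩
    have hfin : ∀ x, Module.Finite B (P x) := fun x => .of_restrictScalars_finite k B (P x)
    choose n g s _ _ hgs using fun x => Module.Finite.exists_comp_eq_id_of_projective B (P x)
    have hf : ∀ (x) (j : Fin (n x)), ∃ f : A →ₗ[k] A, ∀ a, f a = γ (s x (π x a) j) :=
      fun x j => ⟨γ ∘ₗ ((LinearMap.proj j ∘ₗ s x).restrictScalars k) ∘ₗ π x, fun _ => rfl⟩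
    choose f hf using hf
    have hπe : ∀ x a, π x (D.e y * a) = π x a := fun x a => by rw [← γ_one, π_mul, one_smul]
    refine .of_dualBasis (J := Σ x, Fin (n x)) (fun j => ρ j.1 (g j.1 (Pi.single j.2 1)))
      (fun j => f j.1 j.2) (fun j a => ?_) (fun j b a => ?_) (fun a => ?_)
    · rw [hf, hγe]
    · rw [hf, hf, ← γ_γ', smul_eq_mul, π_mul, map_smul, Pi.smul_apply, smul_eq_mul, γ_mul]
    · rw [smul_eq_mul, ← sum_ρ, Fintype.sum_sigma]
      refine Finset.sum_congr rfl fun x _ => ?_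
      have h4 : g x (s x (π x a)) = π x a := LinearMap.congr_fun (hgs x) _
      conv_lhs => rw [← h4, LinearMap.pi_apply_eq_sum_univ (g x), map_sum]
      refine Finset.sum_congr rfl fun j _ => ?_
      rw [sum_ρ, hf, hπe, ρ_smul, smul_eq_mul]
      congr 4
      ext i
      simp [Pi.single_apply, eq_comm]

end CornerData

/-! ### The category algebra of a finite EI category -/

namespace CategoryAlgebra

/-- The objects of a category, preordered by the existence of morphisms. -/
abbrev homPreorder (C : Type u) [Category.{v} C] : Preorder C where
  le x y := Nonempty (x ⟶ y)
  le_refl x := ⟨𝟙 x⟩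
  le_trans _ _ _ := fun ⟨f⟩ ⟨g⟩ => ⟨f ≫ g⟩

attribute [local instance] homPreorder

section Idempotents

variable (k : Type w) [Field k] {C : Type u} [Category.{v} C]

/-- An arrow, as an element of the category algebra. -/
noncomputable abbrev arrow {x y : C} (f : x ⟶ y) : CategoryAlgebra k C := basis k C (Mor.of f)

variable {k}

theorem induction_on {p : CategoryAlgebra k C → Prop} (a : CategoryAlgebra k C)
    (h : ∀ {x y : C} (f : x ⟶ y), p (arrow k f)) (h0 : p 0) (hadd : ∀ a b, p a → p b → p (a + b))
    (hsmul : ∀ (r : k) a, p a → p (r • a)) : p a := by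
  have ha := (basis k C).mem_span a
  induction ha using Submodule.span_induction with
  | mem a ha =>
    obtain ⟨⟨x, y, f⟩, rfl⟩ := ha
    exact h f
  | zero => exact h0
  | add a b _ _ ha hb => exact hadd a b ha hb
  | smul r a _ ha => exact hsmul r a ha

theorem exists_aut_eq (hC : IsEI C) {x : C} (f : x ⟶ x) : ∃ g : Aut x, g.hom = f :=
  have := hC f
  ⟨asIso f, rfl⟩

theorem finite_aut [∀ x y : C, Finite (x ⟶ y)] (x : C) : Finite (Aut x) :=
  Finite.of_injective (fun g : Aut x => g.hom) fun _ _ h => Iso.ext h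

theorem arrow_comp {x y z : C} (f : x ⟶ y) (g : y ⟶ z) : arrow k g * arrow k f = arrow k (f ≫ g) :=
  basis_mul_basis_comp k f g

theorem id_mul_arrow {x y : C} (f : x ⟶ y) : arrow k (𝟙 y) * arrow k f = arrow k f := by
  rw [arrow_comp, Category.comp_id]

theorem arrow_mul_id {x y : C} (f : x ⟶ y) : arrow k f * arrow k (𝟙 x) = arrow k f := by
  rw [arrow_comp, Category.id_comp]

theorem arrow_mul_arrow_of_ne {x y y' z : C} (f : x ⟶ y) (g : y' ⟶ z) (h : y ≠ y') :
    arrow k g * arrow k f = 0 :=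
  basis_mul_basis_of_ne k f g h

variable [Fintype C]

variable (k) in
/-- The identities of the objects, as idempotents of the category algebra of an EI category. The
corner at `x` is the group algebra of `Aut x`; the coefficient at the identity is a Frobenius
functional, with dual bases `g` and `g⁻¹`. -/
noncomputable def cornerData [∀ x y : C, Finite (x ⟶ y)] (hC : IsEI C) :
    CornerData k (CategoryAlgebra k C) C where
  e x := arrow k (𝟙 x)
  e_mul_self x := id_mul_arrow _
  e_mul_of_ne h := arrow_mul_arrow_of_ne _ _ h.symm
  sum_e := by rw [one_def, finsum_eq_sum_of_fintype]
  corner_eq_zero {x y} h a := by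
    induction a using induction_on with
    | @h x' y' f =>
      by_cases hy : y' = y
      · subst hy
        rw [id_mul_arrow]
        refine arrow_mul_arrow_of_ne _ _ fun hx => h ?_
        subst hx
        exact ⟨f⟩
      · rw [arrow_mul_arrow_of_ne _ _ hy, zero_mul]
    | h0 => rw [mul_zero, zero_mul]
    | hadd a b ha hb => rw [mul_add, add_mul, ha, hb, add_zero]
    | hsmul r a ha => rw [mul_smul_comm, smul_mul_assoc, ha, smul_zero]
  exists_iso {x y} := fun ⟨f⟩ ⟨g⟩ => by
    obtain ⟨a, ha⟩ := exists_aut_eq hC (f ≫ g)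
    obtain ⟨b, hb⟩ := exists_aut_eq hC (g ≫ f)
    have h1 : f ≫ g ≫ a.inv = 𝟙 x := by rw [← Category.assoc, ← ha, a.hom_inv_id]
    have h2 : b.inv ≫ g ≫ f = 𝟙 y := by rw [← hb, b.inv_hom_id]
    have h3 : g ≫ a.inv = b.inv ≫ g := by
      calc g ≫ a.inv = (b.inv ≫ g ≫ f) ≫ g ≫ a.inv := by rw [h2, Category.id_comp]
        _ = b.inv ≫ g ≫ f ≫ g ≫ a.inv := by simp only [Category.assoc]
        _ = b.inv ≫ g := by rw [h1, Category.comp_id]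
    have h4 : (g ≫ a.inv) ≫ f = 𝟙 y := by rw [h3, Category.assoc, h2]
    refine ⟨arrow k f, arrow k (g ≫ a.inv), id_mul_arrow _, arrow_mul_id _, id_mul_arrow _,
      arrow_mul_id _, ?_, ?_⟩
    · rw [arrow_comp, h4]
    · rw [arrow_comp, h1]
  exists_frobenius x := by
    classical
    have := finite_aut x
    have := Fintype.ofFinite (Aut x)
    have key : ∀ f f' : x ⟶ x, (basis k C).coord (Mor.of (𝟙 x)) (arrow k f * arrow k f') =
        if f' ≫ f = 𝟙 x then 1 else 0 := fun f f' => by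
      rw [arrow_comp, Module.Basis.coord_apply, Module.Basis.repr_self, Finsupp.single_apply]
      simp
    suffices h : ∃ (l : CategoryAlgebra k C →ₗ[k] k) (U V : Aut x → CategoryAlgebra k C),
        (∀ g, arrow k (𝟙 x) * U g * arrow k (𝟙 x) = U g) ∧
        (∀ g, arrow k (𝟙 x) * V g * arrow k (𝟙 x) = V g) ∧
        (∀ a, ∑ g, l (arrow k (𝟙 x) * a * arrow k (𝟙 x) * U g) • V g =
          arrow k (𝟙 x) * a * arrow k (𝟙 x)) ∧
        (∀ a, ∑ g, l (V g * (arrow k (𝟙 x) * a * arrow k (𝟙 x))) • U g =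
          arrow k (𝟙 x) * a * arrow k (𝟙 x)) by
      obtain ⟨l, U, V, h1, h2, h3, h4⟩ := h
      let E := Fintype.equivFin (Aut x)
      exact ⟨_, l, U ∘ E.symm, V ∘ E.symm, fun g => h1 _, fun g => h2 _,
        fun a => (E.symm.sum_comp fun g =>
          l (arrow k (𝟙 x) * a * arrow k (𝟙 x) * U g) • V g).trans (h3 a),
        fun a => (E.symm.sum_comp fun g =>
          l (V g * (arrow k (𝟙 x) * a * arrow k (𝟙 x))) • U g).trans (h4 a)⟩
    refine ⟨(basis k C).coord (Mor.of (𝟙 x)), fun g => arrow k g.hom, fun g => arrow k g.inv,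
      fun g => by rw [id_mul_arrow, arrow_mul_id], fun g => by rw [id_mul_arrow, arrow_mul_id],
      fun a => ?_, fun a => ?_⟩
    · induction a using induction_on with
      | @h x' y' f =>
        by_cases hy : y' = x
        · subst hy
          by_cases hx : x' = y'
          · subst hx
            obtain ⟨g₀, rfl⟩ := exists_aut_eq hC f
            simp only [id_mul_arrow, arrow_mul_id, key]
            rw [Finset.sum_eq_single (g₀⁻¹ : Aut x')]
            · change (if g₀.inv ≫ g₀.hom = 𝟙 x' then (1 : k) else 0) • arrow k g₀.hom = _
              rw [if_pos g₀.inv_hom_id, one_smul]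
            · intro g _ hg
              rw [if_neg, zero_smul]
              intro h
              exact hg (Iso.ext ((Iso.comp_hom_eq_id g₀).1 h))
            · simp
          · simp only [id_mul_arrow, arrow_mul_arrow_of_ne _ _ (Ne.symm hx), zero_mul, map_zero,
              zero_smul, Finset.sum_const_zero]
        · simp only [arrow_mul_arrow_of_ne _ _ hy, zero_mul, map_zero, zero_smul,
            Finset.sum_const_zero]
      | h0 => simp
      | hadd a b ha hb =>
        simp only [mul_add, add_mul, map_add, add_smul, Finset.sum_add_distrib, ha, hb]
      | hsmul r a ha =>
        simp only [mul_smul_comm, smul_mul_assoc, map_smul, smul_assoc]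
        rw [← Finset.smul_sum, ha]
    · induction a using induction_on with
      | @h x' y' f =>
        by_cases hy : y' = x
        · subst hy
          by_cases hx : x' = y'
          · subst hx
            obtain ⟨g₀, rfl⟩ := exists_aut_eq hC f
            simp only [id_mul_arrow, arrow_mul_id, key]
            rw [Finset.sum_eq_single g₀]
            · rw [if_pos g₀.hom_inv_id, one_smul]
            · intro g _ hg
              rw [if_neg, zero_smul]
              intro h
              exact hg (Iso.ext ((Iso.comp_inv_eq_id g).1 h).symm)
            · simp
          · simp only [id_mul_arrow, arrow_mul_arrow_of_ne _ _ (Ne.symm hx), mul_zero, map_zero,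
              zero_smul, Finset.sum_const_zero]
        · simp only [arrow_mul_arrow_of_ne _ _ hy, zero_mul, mul_zero, map_zero, zero_smul,
            Finset.sum_const_zero]
      | h0 => simp
      | hadd a b ha hb =>
        simp only [mul_add, add_mul, map_add, add_smul, Finset.sum_add_distrib, ha, hb]
      | hsmul r a ha =>
        simp only [mul_smul_comm, smul_mul_assoc, map_smul, smul_assoc]
        rw [← Finset.smul_sum, ha]

theorem finite [∀ x y : C, Finite (x ⟶ y)] : Module.Finite k (CategoryAlgebra k C) :=
  .of_basis (basis k C)

end Idempotents

/-! ### Components of the category algebra -/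

section Components

variable (k : Type w) [Field k] {C : Type u} [Category.{v} C]

/-- The inclusion of `k Hom(x, y)` into the category algebra. -/
noncomputable def incl (x y : C) : HomModule k x y →ₗ[k] CategoryAlgebra k C :=
  (HomModule.basis k x y).constr k fun f => arrow k f

open Classical in
/-- The projection of the category algebra onto `k Hom(x, y)`. -/
noncomputable def component (x y : C) : CategoryAlgebra k C →ₗ[k] HomModule k x y :=
  (basis k C).constr k fun α => if h : x = α.1 ∧ α.2.1 = y then
    HomModule.basis k x y (eqToHom h.1 ≫ α.2.2 ≫ eqToHom h.2) else 0

/-- The inclusion of the group algebra of `Aut x` into the category algebra. -/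
noncomputable def groupIncl (x : C) : MonoidAlgebra k (Aut x) →ₗ[k] CategoryAlgebra k C :=
  (MonoidAlgebra.basis (Aut x) k).constr k fun g => arrow k g.hom

/-- The isomorphism of `k End(x)` with the group algebra of `Aut x` in an EI category. -/
noncomputable def endToGroup (hC : IsEI C) (x : C) :
    HomModule k x x →ₗ[k] MonoidAlgebra k (Aut x) :=
  (HomModule.basis k x x).constr k fun f => MonoidAlgebra.single (exists_aut_eq hC f).choose 1

variable {k}

theorem incl_basis {x y : C} (f : x ⟶ y) : incl k x y (HomModule.basis k x y f) = arrow k f := by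
  simp [incl]

theorem component_arrow {x y : C} (f : x ⟶ y) :
    component k x y (arrow k f) = HomModule.basis k x y f := by
  simp [component]

theorem component_arrow_of_ne {x y x' y' : C} (f : x' ⟶ y') (h : ¬ (x = x' ∧ y' = y)) :
    component k x y (arrow k f) = 0 := by
  simp only [component, Module.Basis.constr_basis]
  exact dif_neg h

theorem groupIncl_single {x : C} (g : Aut x) (r : k) :
    groupIncl k x (MonoidAlgebra.single g r) = r • arrow k g.hom := by
  have h : (MonoidAlgebra.single g r : MonoidAlgebra k (Aut x)) =
      r • MonoidAlgebra.basis (Aut x) k g := by simp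
  rw [h, map_smul, groupIncl, Module.Basis.constr_basis]

theorem endToGroup_basis (hC : IsEI C) {x : C} (g : Aut x) :
    endToGroup k hC x (HomModule.basis k x x g.hom) = MonoidAlgebra.single g 1 := by
  rw [endToGroup, Module.Basis.constr_basis]
  congr 1
  exact Iso.ext (exists_aut_eq hC g.hom).choose_spec

theorem component_incl {x y : C} (p : HomModule k x y) : component k x y (incl k x y p) = p := by
  have h : component k x y ∘ₗ incl k x y = LinearMap.id :=
    (HomModule.basis k x y).ext fun f => by
      rw [LinearMap.comp_apply, incl_basis, component_arrow, LinearMap.id_apply]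
  exact LinearMap.congr_fun h p

theorem endToGroup_component_groupIncl (hC : IsEI C) {x : C} (b : MonoidAlgebra k (Aut x)) :
    endToGroup k hC x (component k x x (groupIncl k x b)) = b := by
  induction b using MonoidAlgebra.induction_linear with
  | zero => simp only [map_zero]
  | add a b ha hb => rw [map_add, map_add, map_add, ha, hb]
  | single g r =>
    rw [groupIncl_single, map_smul, component_arrow, map_smul, endToGroup_basis]
    simp

theorem incl_injective (x y : C) : Function.Injective (incl k x y) :=
  Function.LeftInverse.injective component_incl

theorem finite_homModule [∀ x y : C, Finite (x ⟶ y)] (x y : C) :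
    Module.Finite k (HomModule k x y) :=
  .of_basis (HomModule.basis k x y)

variable [Fintype C]

theorem sum_id : ∑ x, arrow k (𝟙 x) = (1 : CategoryAlgebra k C) := by
  rw [one_def, finsum_eq_sum_of_fintype]

theorem groupIncl_endToGroup_component (hC : IsEI C) {x : C} (a : CategoryAlgebra k C) :
    groupIncl k x (endToGroup k hC x (component k x x a)) = arrow k (𝟙 x) * a * arrow k (𝟙 x) := by
  induction a using induction_on with
  | @h x' y' f =>
    by_cases hy : y' = x
    · subst hy
      by_cases hx : y' = x'
      · subst hx
        obtain ⟨g, rfl⟩ := exists_aut_eq hC f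
        rw [component_arrow, endToGroup_basis, groupIncl_single, id_mul_arrow, arrow_mul_id,
          one_smul]
      · rw [component_arrow_of_ne f (by simpa using hx), map_zero, map_zero, id_mul_arrow,
          arrow_mul_arrow_of_ne _ _ hx]
    · rw [component_arrow_of_ne f (by tauto), map_zero, map_zero, arrow_mul_arrow_of_ne _ _ hy,
        zero_mul]
  | h0 => simp only [map_zero, mul_zero, zero_mul]
  | hadd a b ha hb => simp only [map_add, mul_add, add_mul, ha, hb]
  | hsmul r a ha => simp only [map_smul, mul_smul_comm, smul_mul_assoc, ha]

theorem groupIncl_one (x : C) : groupIncl k x 1 = arrow k (𝟙 x) := by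
  rw [MonoidAlgebra.one_def, groupIncl_single, one_smul]
  rfl

theorem groupIncl_mul {x : C} (a b : MonoidAlgebra k (Aut x)) :
    groupIncl k x (a * b) = groupIncl k x a * groupIncl k x b := by
  induction a using MonoidAlgebra.induction_linear with
  | zero => simp only [map_zero, zero_mul]
  | add a a' ha ha' => rw [add_mul, map_add, map_add, add_mul, ha, ha']
  | single g r =>
    induction b using MonoidAlgebra.induction_linear with
    | zero => simp only [map_zero, mul_zero]
    | add b b' hb hb' => rw [mul_add, map_add, map_add, mul_add, hb, hb']
    | single h s =>
      rw [MonoidAlgebra.single_mul_single, groupIncl_single, groupIncl_single, groupIncl_single,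
        smul_mul_smul_comm, arrow_comp]
      rfl

theorem incl_left_smul {x y : C} (b : MonoidAlgebra k (Aut y)) (p : HomModule k x y) :
    incl k x y (b • p) = groupIncl k y b * incl k x y p := by
  induction b using MonoidAlgebra.induction_linear with
  | zero => simp only [map_zero, zero_mul, zero_smul]
  | add a a' ha ha' => rw [add_smul, map_add, map_add, add_mul, ha, ha']
  | single g r =>
    have h : incl k x y ∘ₗ (MonoidAlgebra.lift k (Module.End k (HomModule k x y)) (Aut y)
        (HomModule.leftHom k x y)) (MonoidAlgebra.single g r) =
        LinearMap.mulLeft k (groupIncl k y (MonoidAlgebra.single g r)) ∘ₗ incl k x y := by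
      refine (HomModule.basis k x y).ext fun f => ?_
      have h1 := congrArg (incl k x y) (HomModule.left_smul_basis k x y g r f)
      refine h1.trans ?_
      rw [LinearMap.comp_apply, LinearMap.mulLeft_apply, map_smul, incl_basis, incl_basis,
        groupIncl_single, smul_mul_assoc, arrow_comp]
    exact LinearMap.congr_fun h p

theorem incl_right_smul {x y : C} (b : (MonoidAlgebra k (Aut x))ᵐᵒᵖ) (p : HomModule k x y) :
    incl k x y (b • p) = incl k x y p * groupIncl k x b.unop := by
  obtain ⟨b, rfl⟩ := MulOpposite.op_surjective b
  rw [MulOpposite.unop_op]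
  induction b using MonoidAlgebra.induction_linear with
  | zero => simp only [map_zero, mul_zero, MulOpposite.op_zero, zero_smul]
  | add a a' ha ha' => rw [MulOpposite.op_add, add_smul, map_add, map_add, mul_add, ha, ha']
  | single g r =>
    have h : incl k x y ∘ₗ (MonoidAlgebra.lift k (Module.End k (HomModule k x y))ᵐᵒᵖ (Aut x)
        (HomModule.rightHom k x y) (MonoidAlgebra.single g r)).unop =
        LinearMap.mulRight k (groupIncl k x (MonoidAlgebra.single g r)) ∘ₗ incl k x y := by
      refine (HomModule.basis k x y).ext fun f => ?_
      have h1 := congrArg (incl k x y) (HomModule.right_smul_basis k x y g r f)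
      refine h1.trans ?_
      rw [LinearMap.comp_apply, LinearMap.mulRight_apply, map_smul, incl_basis, incl_basis,
        groupIncl_single, mul_smul_comm, arrow_comp]
    exact LinearMap.congr_fun h p

theorem incl_component (x y : C) (a : CategoryAlgebra k C) :
    incl k x y (component k x y a) = arrow k (𝟙 y) * a * arrow k (𝟙 x) := by
  induction a using induction_on with
  | @h x' y' f =>
    by_cases hy : y' = y
    · subst hy
      by_cases hx : x = x'
      · subst hx
        rw [component_arrow, incl_basis, id_mul_arrow, arrow_mul_id]
      · rw [component_arrow_of_ne f (by simpa using hx), map_zero, id_mul_arrow,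
          arrow_mul_arrow_of_ne _ _ hx]
    · rw [component_arrow_of_ne f (by tauto), map_zero, arrow_mul_arrow_of_ne _ _ hy, zero_mul]
  | h0 => simp only [map_zero, mul_zero, zero_mul]
  | hadd a b ha hb => simp only [map_add, mul_add, add_mul, ha, hb]
  | hsmul r a ha => simp only [map_smul, mul_smul_comm, smul_mul_assoc, ha]

theorem id_mul_groupIncl {x : C} (b : MonoidAlgebra k (Aut x)) :
    arrow k (𝟙 x) * groupIncl k x b = groupIncl k x b := by
  rw [← groupIncl_one, ← groupIncl_mul, one_mul]

theorem groupIncl_mul_id {x : C} (b : MonoidAlgebra k (Aut x)) :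
    groupIncl k x b * arrow k (𝟙 x) = groupIncl k x b := by
  rw [← groupIncl_one, ← groupIncl_mul, mul_one]

theorem component_groupIncl_mul (x y : C) (b : MonoidAlgebra k (Aut y)) (a : CategoryAlgebra k C) :
    component k x y (groupIncl k y b * a) = b • component k x y a := by
  apply incl_injective
  rw [incl_left_smul, incl_component, incl_component, ← mul_assoc, ← mul_assoc, ← mul_assoc,
    id_mul_groupIncl, groupIncl_mul_id]

theorem component_mul_groupIncl (x y : C) (b : (MonoidAlgebra k (Aut x))ᵐᵒᵖ)
    (a : CategoryAlgebra k C) :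
    component k x y (a * groupIncl k x b.unop) = b • component k x y a := by
  apply incl_injective
  rw [incl_right_smul, incl_component, incl_component, mul_assoc, mul_assoc, mul_assoc, mul_assoc,
    id_mul_groupIncl, groupIncl_mul_id]

variable [∀ x y : C, Finite (x ⟶ y)]

/-- The left regular module has a projective component at `y` if and only if all `k Hom(x, y)` are
projective over the group algebra of `Aut y`. -/
theorem isCornerProjective_left_iff (hC : IsEI C) (y : C) :
    (cornerData k hC).IsCornerProjective (CategoryAlgebra k C) y ↔
      ∀ x, Module.Projective (MonoidAlgebra k (Aut y)) (HomModule k x y) := by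
  have := fun x => finite_homModule (k := k) x y
  refine CornerData.isCornerProjective_iff (groupIncl k y)
    (endToGroup k hC y ∘ₗ component k y y) (fun x => incl k x y) (fun x => component k x y)
    (groupIncl_one y) groupIncl_mul (groupIncl_endToGroup_component hC)
    (endToGroup_component_groupIncl hC) (fun x => incl_left_smul)
    (fun x => component_groupIncl_mul x y) (fun x => component_incl) fun a => ?_
  simp only [incl_component]
  rw [← Finset.mul_sum, sum_id, mul_one]
  rfl

/-- The right regular module has a projective component at `x` if and only if all `k Hom(x, y)` are
projective right modules over the group algebra of `Aut x`. -/
theorem isCornerProjective_right_iff (hC : IsEI C) (x : C) :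
    (cornerData k hC).op.IsCornerProjective (CategoryAlgebra k C)ᵐᵒᵖ (OrderDual.toDual x) ↔
      ∀ y, Module.Projective (MonoidAlgebra k (Aut x))ᵐᵒᵖ (HomModule k x y) := by
  have := fun y => finite_homModule (k := k) x y
  let E : CategoryAlgebra k C ≃ₗ[k] (CategoryAlgebra k C)ᵐᵒᵖ := MulOpposite.opLinearEquiv k
  let E' : MonoidAlgebra k (Aut x) ≃ₗ[k] (MonoidAlgebra k (Aut x))ᵐᵒᵖ := MulOpposite.opLinearEquiv k
  refine CornerData.isCornerProjective_iff
    (E.toLinearMap ∘ₗ groupIncl k x ∘ₗ E'.symm.toLinearMap)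
    (E'.toLinearMap ∘ₗ (endToGroup k hC x ∘ₗ component k x x) ∘ₗ E.symm.toLinearMap)
    (fun y => E.toLinearMap ∘ₗ incl k x y) (fun y => component k x y ∘ₗ E.symm.toLinearMap)
    (congrArg E (groupIncl_one x)) (fun a b => congrArg E (groupIncl_mul b.unop a.unop))
    (fun a => congrArg E ((groupIncl_endToGroup_component hC a.unop).trans (mul_assoc _ _ _)))
    (fun b => congrArg E' (endToGroup_component_groupIncl hC b.unop))
    (fun y b p => congrArg E (incl_right_smul b p))
    (fun y b a => component_mul_groupIncl x y b a.unop) (fun y => component_incl) fun a => ?_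
  change ∑ y, E (incl k x y (component k x y a.unop)) = E (a.unop * arrow k (𝟙 x))
  rw [← map_sum]
  simp only [incl_component]
  rw [← Finset.sum_mul, ← Finset.sum_mul, sum_id, one_mul]

end Components

end CategoryAlgebra

end EICat

theorem proposition1p2 (k : Type w) [Field k] (C : Type u) [CategoryTheory.Category.{v} C]
    [Finite C] [∀ x y : C, Finite (x ⟶ y)] (hC : EICat.IsEI C) :
    EICat.IsGorenstein (EICat.CategoryAlgebra k C) ↔ EICat.IsProjectiveOver k C := by
  have := Fintype.ofFinite C
  let _ := EICat.CategoryAlgebra.homPreorder C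
  let D := EICat.CategoryAlgebra.cornerData k hC
  have hfin : Module.Finite k (EICat.CategoryAlgebra k C) := EICat.CategoryAlgebra.finite
  have hfin' : Module.Finite k (EICat.CategoryAlgebra k C)ᵐᵒᵖ :=
    .equiv (MulOpposite.opLinearEquiv k)
  -- the two descriptions of the right regular module
  let E : EICat.CategoryAlgebra k C ≃ₗ[(EICat.CategoryAlgebra k C)ᵐᵒᵖ]
      (EICat.CategoryAlgebra k C)ᵐᵒᵖ :=
    { MulOpposite.opAddEquiv with map_smul' := fun a x => rfl }
  constructor
  · intro h x y
    have hl := (EICat.hasFiniteInjectiveDimension_iff _).2 h.left_injectiveDimension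
    have hr := ((EICat.hasFiniteInjectiveDimension_iff _).2 h.right_injectiveDimension).of_retract
      E.symm.toLinearMap E.toLinearMap E.apply_symm_apply
    exact ⟨(EICat.CategoryAlgebra.isCornerProjective_left_iff hC y).1
        (EICat.CornerData.isCornerProjective_of_hasFiniteInjectiveDimension (k := k) hl y) x,
      (EICat.CategoryAlgebra.isCornerProjective_right_iff hC x).1
        (EICat.CornerData.isCornerProjective_of_hasFiniteInjectiveDimension (k := k) hr _) y⟩
  · intro h
    have hl : ∀ y, D.IsCornerProjective (EICat.CategoryAlgebra k C) y := fun y =>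
      (EICat.CategoryAlgebra.isCornerProjective_left_iff hC y).2 fun x => (h x y).1
    have hr : ∀ x, D.op.IsCornerProjective (EICat.CategoryAlgebra k C)ᵐᵒᵖ x := fun x =>
      (EICat.CategoryAlgebra.isCornerProjective_right_iff hC (OrderDual.ofDual x)).2
        fun y => (h _ y).2
    exact
      { left_noetherian := isNoetherian_of_tower k inferInstance
        right_noetherian := isNoetherian_of_tower k inferInstance
        left_injectiveDimension := (EICat.hasFiniteInjectiveDimension_iff _).1
          (EICat.CornerData.hasFiniteInjectiveDimension_left.{w, max u v} hl hr)
        right_injectiveDimension := (EICat.hasFiniteInjectiveDimension_iff _).1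
          (EICat.CornerData.hasFiniteInjectiveDimension_of_isCornerProjective.{w, max u v}
            hl hr) }
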